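/- **Setting.** Let $L\ge 1$. Consider the $L\times L$ square lattice with periodic boundary conditions, with one qubit at each vertex and one at the center of each edge ($3L^2$ qubits). A triangle $T=(u,f,g)$ is given by a plaquette and one of its four corners: $u$ is the corner vertex, and $f,g$ are the two edges of the plaquette meeting there (so there are $4L^2$ triangles, labelled by plaquette and corner). Put $G(T)=X_uX_fX_g$ if $u$ is the south-west (SW) or north-east (NE) corner, and $G(T)=Z_uZ_fZ_g$ if $u$ is the south-east (SE) or north-west (NW) corner. Let $$H=-\sum_T G(T),\quad S^X_p=G(T^{SW}_p)G(T^{NE}_p),\quad S^Z_p=G(T^{SE}_p)G(T^{NW}_p),\quad \overline X_p=G(T^{SW}_p),\quad \overline Z_p=G(T^{SE}_p),$$ where $p$ runs over plaquettes. For $x,z\in\{\pm1\}^{\text{plaquettes}}$ the syndrome sector $V(x,z)$ is the space of states $\psi$ with $S^X_p\psi=x_p\psi$ and $S^Z_p\psi=z_p\psi$ for all $p$. Put $E_0=-2\sqrt2\,L^2$. **Sectors.** $H$ is self-adjoint, and the state space is the orthogonal direct sum of the sectors $V(x,z)$. One has $V(x,z)\ne0$ if and only if $\prod_p x_p=\prod_p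 z_p=1$. In particular, syndrome excitations occur only in pairs: in every nonzero sector the number of $p$ with $x_p=-1$ and the number of $p$ with $z_p=-1$ are both even. **Gauge qubits.** For $\psi\in V(x,z)$, $$H\psi=-\sum_p\big[(1+x_p)\overline X_p\psi+(1+z_p)\overline Z_p\psi\big].$$ Every nonzero sector is invariant under all $\overline X_p,\overline Z_p$ and is unitarily equivalent to the space of $L^2+2$ qubits, in such a way that $\overline X_p,\overline Z_p$ become the Pauli operators $X,Z$ of the $p$-th of $L^2$ independent gauge qubits. Accordingly $H$ becomes $-\sum_p[(1+x_p)X_p+(1+z_p)Z_p]$, and it acts trivially on the two remaining (logical) qubits. Let $\epsilon_0(a,b)$ and $\epsilon_1(a,b)$ be the smallest and the largest eigenvalue of the one-qubit operator $-(1+a)X-(1+b)Z$, $a,b=\pm1$. Then $(\epsilon_0,\epsilon_1)$ equals $(-2\sqrt2,2\sqrt2)$ at $(1,1)$, $(-2,2)$ at $(1,-1)$ and at $(-1,1)$, and $(0,0)$ at $(-1,-1)$. The multiplicity of a number $\mu$ as an eigenvalue of $H$ on a nonzero sector $V(x,z)$ is $4$ times the number of $e\in\{0,1\}^{\text{plaquettes}}$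 with $\sum_p\epsilon_{e_p}(x_p,z_p)=\mu$. **Ground states.** The smallest eigenvalue of $H$ is $E_0$. Its eigenspace lies in the trivial sector $x_p=z_p=1$ and has dimension $4$. **Gauge excitations.** $\epsilon_1(1,1)-\epsilon_0(1,1)=4\sqrt2$. There are $a,b\in\mathbb C$ such that, for every $p$, the operator $a\overline X_p+b\overline Z_p$ maps ground states isometrically to states of the trivial sector that are eigenstates of $H$ with energy $E_0+4\sqrt2$. For every integer $k\ge0$, the multiplicity of $E_0+4\sqrt2\,k$ on the trivial sector is $4\binom{L^2}{k}$. **Syndrome excitations.** $\epsilon_0(1,-1)-\epsilon_0(1,1)=\epsilon_0(-1,1)-\epsilon_0(1,1)=2(\sqrt2-1)$. For $p\ne q$, the lowest energy of $H$ in the sector in which exactly $x_p,x_q$ (or exactly $z_p,z_q$) are flipped to $-1$ is $E_0+2\cdot2(\sqrt2-1)$. In general, the lowest energy in a nonzero sector $V(x,z)$ is $E_0+2(\sqrt2-1)\,n_1+2\sqrt2\,n_2$, where $n_1$ is the number of plaquettes at which exactly one of $x_p,z_p$ equals $-1$, and $n_2$ the number of those at which both do. **Gap.** Every eigenvalue of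 $H$ other than $E_0$ is at least $E_0+4(\sqrt2-1)$. For $L\ge2$ this value is the smallest eigenvalue above $E_0$, so the spectral gap is exactly $4(\sqrt2-1)$, independently of $L$. -/

import Mathlib

/-! ### Qubits and Pauli operators -/

/-- The Hilbert space `(ℂ²)^{⊗ Q}` of a family of qubits labelled by `Q`: square-summable
amplitudes indexed by the computational basis states `s : Q → Bool`
(`false` is `|0⟩`, `true` is `|1⟩`). -/
abbrev QubitSpace (Q : Type) [Fintype Q] : Type := EuclideanSpace ℂ (Q → Bool)

/-- The Pauli operator `X` acting on the qubit `q` (and trivially elsewhere). -/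
def pauliX {Q : Type} [Fintype Q] [DecidableEq Q] (q : Q) : Module.End ℂ (QubitSpace Q) where
  toFun ψ := WithLp.toLp 2 (fun s => ψ (Function.update s q (!(s q))))
  map_add' _ _ := rfl
  map_smul' _ _ := rfl

/-- The Pauli operator `Z` acting on the qubit `q` (and trivially elsewhere). -/
def pauliZ {Q : Type} [Fintype Q] (q : Q) : Module.End ℂ (QubitSpace Q) where
  toFun ψ := WithLp.toLp 2 (fun s => (if s q then (-1 : ℂ) else 1) * ψ s)
  map_add' ψ φ := by ext s; simp [mul_add]
  map_smul' c ψ := by ext s; simp [mul_left_comm]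

/-! ### The `L × L` square lattice with periodic boundary conditions -/

/-- Sites of the torus. They label the vertices, and also the plaquettes: the plaquette `p` is the
one whose south-west corner is the vertex `p`. First coordinate: eastwards; second: northwards. -/
abbrev Site (L : ℕ) : Type := ZMod L × ZMod L

/-- Locations of code qubits attached to a site `(i, j)`: the vertex `(i, j)` itself, the center of
the horizontal edge from `(i, j)` to `(i + 1, j)`, and the center of the vertical edge from
`(i, j)` to `(i, j + 1)`. -/
inductive QubitKind : Type
  | vertex | hEdge | vEdge
  deriving DecidableEq

instance : Fintype QubitKind where
  elems := {.vertex, .hEdge, .vEdge}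
  complete q := by cases q <;> simp

/-- The `3 L ^ 2` code qubits. -/
abbrev CodeQubit (L : ℕ) : Type := QubitKind × Site L

/-- The position of the corner vertex of a triangle in its plaquette. -/
inductive Corner : Type
  | NW | NE | SW | SE
  deriving DecidableEq

instance : Fintype Corner where
  elems := {.NW, .NE, .SW, .SE}
  complete c := by cases c <;> simp

/-- A triangle is a plaquette together with one of its four corners. -/
abbrev Triangle (L : ℕ) : Type := Site L × Corner

namespace Triangle

/-- The corner vertex `u` of the triangle. -/
def vertex {L : ℕ} : Triangle L → CodeQubit L
  | ((i, j), .SW) => (.vertex, (i, j))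
  | ((i, j), .SE) => (.vertex, (i + 1, j))
  | ((i, j), .NW) => (.vertex, (i, j + 1))
  | ((i, j), .NE) => (.vertex, (i + 1, j + 1))

/-- The horizontal edge of the triangle: the bottom (south) or top (north) edge of its plaquette. -/
def hEdge {L : ℕ} : Triangle L → CodeQubit L
  | ((i, j), .SW) => (.hEdge, (i, j))
  | ((i, j), .SE) => (.hEdge, (i, j))
  | ((i, j), .NW) => (.hEdge, (i, j + 1))
  | ((i, j), .NE) => (.hEdge, (i, j + 1))

/-- The vertical edge of the triangle: the left (west) or right (east) edge of its plaquette. -/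
def vEdge {L : ℕ} : Triangle L → CodeQubit L
  | ((i, j), .SW) => (.vEdge, (i, j))
  | ((i, j), .SE) => (.vEdge, (i + 1, j))
  | ((i, j), .NW) => (.vEdge, (i, j))
  | ((i, j), .NE) => (.vEdge, (i + 1, j))

end Triangle

section Model

variable (L : ℕ) [NeZero L]

/-- The state space of the `3 L ^ 2` code qubits. -/
abbrev CodeSpace : Type := QubitSpace (CodeQubit L)

/-- The triangle operator `G(T)`: `XXX` on south-west and north-east triangles,
`ZZZ` on south-east and north-west triangles. -/
def triangleOp (T : Triangle L) : Module.End ℂ (CodeSpace L) :=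
  match T.2 with
  | .SW | .NE => pauliX T.vertex * pauliX T.hEdge * pauliX T.vEdge
  | .SE | .NW => pauliZ T.vertex * pauliZ T.hEdge * pauliZ T.vEdge

/-- The Hamiltonian `H = - ∑_T G(T)`. -/
def hamiltonian : Module.End ℂ (CodeSpace L) := -∑ T : Triangle L, triangleOp L T

/-- The stabilizer `S^X_p = G(T^SW_p) G(T^NE_p)`. -/
def stabX (p : Site L) : Module.End ℂ (CodeSpace L) :=
  triangleOp L (p, .SW) * triangleOp L (p, .NE)

/-- The stabilizer `S^Z_p = G(T^SE_p) G(T^NW_p)`. -/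
def stabZ (p : Site L) : Module.End ℂ (CodeSpace L) :=
  triangleOp L (p, .SE) * triangleOp L (p, .NW)

/-- The logical operator `X̄_p = G(T^SW_p)` of the gauge qubit at the plaquette `p`. -/
def gaugeX (p : Site L) : Module.End ℂ (CodeSpace L) := triangleOp L (p, .SW)

/-- The logical operator `Z̄_p = G(T^SE_p)` of the gauge qubit at the plaquette `p`. -/
def gaugeZ (p : Site L) : Module.End ℂ (CodeSpace L) := triangleOp L (p, .SE)

/-- The sector of states with syndrome `x, z`:
`S^X_p ψ = x_p ψ` and `S^Z_p ψ = z_p ψ` for all plaquettes `p`. -/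
def sector (x z : Site L → ℤˣ) : Submodule ℂ (CodeSpace L) :=
  ⨅ p : Site L, Module.End.eigenspace (stabX L p) ((x p : ℤ) : ℂ) ⊓
    Module.End.eigenspace (stabZ L p) ((z p : ℤ) : ℂ)

/-- The energy levels of `H` (its real eigenvalues). -/
def energyLevels : Set ℝ := {μ | (hamiltonian L).HasEigenvalue (μ : ℂ)}

/-- The energy levels of `H` attained by states with syndrome `x, z`. -/
def sectorLevels (x z : Site L → ℤˣ) : Set ℝ :=
  {μ | ∃ ψ ∈ sector L x z, ψ ≠ 0 ∧ hamiltonian L ψ = (μ : ℂ) • ψ}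

/-- The ground state energy `E₀ = -2√2 L²`. -/
noncomputable def groundEnergy : ℝ := -2 * Real.sqrt 2 * (L : ℝ) ^ 2

end Model

/-! ### One gauge qubit -/

/-- The Hamiltonian `-(1 + x) X - (1 + z) Z` of one qubit with fixed syndrome bits `x, z = ±1`. -/
noncomputable def gaugeQubitHam (x z : ℤˣ) : Module.End ℂ (QubitSpace Unit) :=
  -((1 + ((x : ℤ) : ℂ)) • pauliX () + (1 + ((z : ℤ) : ℂ)) • pauliZ ())

/-- The real eigenvalues of one gauge qubit. -/
def gaugeQubitLevels (x z : ℤˣ) : Set ℝ := {μ | (gaugeQubitHam x z).HasEigenvalue (μ : ℂ)}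

/-- The smallest eigenvalue of a gauge qubit. -/
noncomputable def eps0 (x z : ℤˣ) : ℝ := sInf (gaugeQubitLevels x z)

/-- The largest eigenvalue of a gauge qubit. -/
noncomputable def eps1 (x z : ℤˣ) : ℝ := sSup (gaugeQubitLevels x z)

/-- The total energy of the gauge qubits for the syndrome `x, z`, where `e p` tells whether the
gauge qubit `p` is in its excited (`true`) or its ground (`false`) level. -/
noncomputable def configEnergy (L : ℕ) [NeZero L] (x z : Site L → ℤˣ) (e : Site L → Bool) : ℝ :=
  ∑ p, if e p then eps1 (x p) (z p) else eps0 (x p) (z p)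

/-- The syndrome pattern in which exactly the bits at the plaquettes `p` and `q` are flipped. -/
def pairFlip {L : ℕ} (p q : Site L) : Site L → ℤˣ := fun r => if r = p ∨ r = q then -1 else 1

/-! ### Commuting involutions and the qubit structure they generate -/

/-! Every triangle operator is a product of `X`s or of `Z`s, so it is recorded by a bit vector, and
two such operators of opposite type commute or anticommute according to the parity of their overlap,
a dot product over the two-element field `Bool`. A `Z`-triangle and an `X`-triangle overlap in an
odd number of qubits exactly when they belong to the same plaquette. Hence the stabilizers, which
contain two triangles of one plaquette, commute with all triangle operators, while the pairs `gaugeX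
p`, `gaugeZ p` anticommute on each plaquette and commute across plaquettes. In a sector the second
triangle of each type equals the first up to the sign `x p` or `z p`, so `H` becomes a sum of
one-qubit terms.

The dimension of a sector is the trace of its projector, an average of signed products of
stabilizers (`mul_finrank_iInf_eigenspace`). Non-identity Paulis are traceless, so only the
relations among stabilizers contribute. The edges force a relation to be constant on the torus,
which leaves the empty and the full product for each type; `finrank_sector_eq` follows. With `N`
plaquettes a nonzero sector has dimension `2 ^ (N + 2)`, and `N` independent anticommuting pairs on
such a space are the Paulis of `N` out of `N + 2` qubits (`exists_qubit_isometry`).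

The field on a gauge qubit is the vector with entries `1 + x` and `1 + z`. Rotating each Pauli pair
so that this vector points along `Z` makes `H` diagonal (`exists_diagonalizing_qubits`), and
eigenvalue multiplicities become counts of bit strings, the two logical qubits giving the factor 4.
For the gap, flips of each type are even in number, so a nontrivial syndrome has at least two. A
lone flip costs `2(√2 - 1)`, a plaquette with both flips costs `2√2`, which is more than two lone
flips, and a gauge excitation costs `4√2`. -/

/-- Bit vectors are sums of unit vectors, so a statement about products of involutions can be proved
by adjoining one generator at a time. -/
theorem boolFun_induction {ι : Type*} [Fintype ι] [DecidableEq ι] {P : (ι → Bool) → Prop}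
    (h0 : P 0) (hs : ∀ i s, P s → P (Pi.single i true + s)) (s : ι → Bool) : P s := by
  suffices h : ∀ A : Finset ι, P (∑ i ∈ A, Pi.single i (s i)) by
    simpa only [Finset.univ_sum_single] using h Finset.univ
  intro A
  induction A using Finset.induction_on with
  | empty => simpa using h0
  | insert i A hi ih =>
    rw [Finset.sum_insert hi]
    cases h : s i with
    | false =>
      have : (Pi.single i false : ι → Bool) = 0 := Pi.single_zero i
      rwa [this, zero_add]
    | true => exact hs i _ ih

theorem single_true_add {ι : Type*} [DecidableEq ι] (i : ι) (s : ι → Bool) :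
    Pi.single i true + s = Function.update s i (!(s i)) := by
  funext j
  by_cases h : j = i
  · subst h
    simp [Bool.add_eq_xor]
  · simp [h, Bool.add_eq_xor, Bool.zero_eq_false]

theorem boolFun_add_self {ι : Type*} (s : ι → Bool) : s + s = 0 := by
  funext i
  exact Bool.xor_self (s i)

/-- Each involution is a homomorphism from the two-element group, and homomorphisms with commuting
images combine into one on the product. Thus `ρ s` is the product of the `X i` marked by `s`. -/
theorem exists_flip_hom {ι M : Type*} [Fintype ι] [DecidableEq ι] [Monoid M] (X : ι → M)
    (hX : ∀ i, X i * X i = 1) (hc : ∀ i j, Commute (X i) (X j)) :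
    ∃ ρ : (ι → Bool) → M, ρ 0 = 1 ∧ (∀ s t, ρ (s + t) = ρ s * ρ t) ∧
      ∀ i, ρ (Pi.single i true) = X i := by
  let f : ∀ i, Multiplicative Bool →* M := fun i =>
    { toFun := fun b => if b.toAdd then X i else 1
      map_one' := rfl
      map_mul' := by
        intro a b
        obtain ⟨a, rfl⟩ := Multiplicative.ofAdd.surjective a
        obtain ⟨b, rfl⟩ := Multiplicative.ofAdd.surjective b
        rw [← ofAdd_add]
        cases a <;> cases b <;> simp [Bool.add_eq_xor, hX] }
  have hf : Pairwise fun i j => ∀ x y, Commute (f i x) (f j y) := by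
    intro i j _ x y
    change Commute (if x.toAdd then X i else 1) (if y.toAdd then X j else 1)
    split_ifs <;> simp [hc]
  let F := MonoidHom.noncommPiCoprod f hf
  refine ⟨fun s => F (fun i => Multiplicative.ofAdd (s i)), ?_, ?_, ?_⟩
  · exact map_one F
  · intro s t
    exact map_mul F (fun i => Multiplicative.ofAdd (s i)) (fun i => Multiplicative.ofAdd (t i))
  · intro i
    have h : (fun j => Multiplicative.ofAdd ((Pi.single i true : ι → Bool) j)) =
        Pi.mulSingle i (Multiplicative.ofAdd true) := by
      funext j
      by_cases h : j = i
      · subst h; simp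
      · simp [h]
    change F _ = _
    rw [h, MonoidHom.noncommPiCoprod_mulSingle]
    simp [f]

section QubitStructure

open Module.End

theorem eigenvalue_of_sq_eq_one {V : Type*} [AddCommGroup V] [Module ℂ V] {A : Module.End ℂ V}
    (hA : A * A = 1) {v : V} (hv : v ≠ 0) {c : ℂ} (h : A v = c • v) : c = 1 ∨ c = -1 := by
  have h2 : (c * c) • v = (1 : ℂ) • v := by
    rw [mul_smul, ← h, ← map_smul, ← h, ← Module.End.mul_apply, hA, one_smul]; rfl
  exact mul_self_eq_one_iff.1 (smul_left_injective ℂ hv h2)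

/-- Anticommuting pairs of self-adjoint involutions `X i`, `Z i`, with different pairs commuting,
act on a space of dimension `2 ^ (|ι| + |κ|)` as the Pauli operators of the first `|ι|` of
`|ι| + |κ|` qubits. -/
theorem exists_qubit_isometry {ι κ : Type} [Fintype ι] [DecidableEq ι] [Fintype κ] [DecidableEq κ]
    {V : Type*} [NormedAddCommGroup V] [InnerProductSpace ℂ V] [FiniteDimensional ℂ V]
    (X Z : ι → Module.End ℂ V) (hXs : ∀ i, (X i).IsSymmetric) (hZs : ∀ i, (Z i).IsSymmetric)
    (hX : ∀ i, X i * X i = 1) (hZ : ∀ i, Z i * Z i = 1)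
    (hXX : ∀ i j, Commute (X i) (X j)) (hZZ : ∀ i j, Commute (Z i) (Z j))
    (hZX : ∀ i j, Z i * X j = if i = j then -(X j * Z i) else X j * Z i)
    (hdim : Module.finrank ℂ V = 2 ^ (Fintype.card ι + Fintype.card κ)) :
    ∃ W : QubitSpace (ι ⊕ κ) ≃ₗᵢ[ℂ] V,
      (∀ i φ, X i (W φ) = W (pauliX (Sum.inl i) φ)) ∧
      (∀ i φ, Z i (W φ) = W (pauliZ (Sum.inl i) φ)) := by
  obtain ⟨ρ, hρ0, hρa, hρ1⟩ := exists_flip_hom X hX hXX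
  have hρX : ∀ i s, ρ (Pi.single i true + s) = X i * ρ s := fun i s => by rw [hρa, hρ1]
  have hρρ : ∀ s v, ρ s (ρ s v) = v := fun s v => by
    rw [← Module.End.mul_apply, ← hρa, boolFun_add_self, hρ0]; rfl
  have hρsymm : ∀ s, (ρ s).IsSymmetric := by
    refine boolFun_induction ?_ ?_
    · rw [hρ0]; exact fun _ _ => rfl
    · intro i s ih
      rw [hρX]
      refine (hXs i).mul_of_commute ih ?_
      rw [commute_iff_eq, ← hρ1, ← hρa, add_comm, hρa]
  have hρinner : ∀ s v w, inner ℂ (ρ s v) (ρ s w) = inner ℂ v w := fun s v w => by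
    rw [hρsymm s v, hρρ]
  -- Each factor `X i` of `ρ s` contributes one sign when `Z i` moves past it, so `ρ s` permutes the
  -- joint eigenspaces of the `Z i`.
  have hZρ : ∀ i s, Z i * ρ s = (if s i then (-1 : ℂ) else 1) • (ρ s * Z i) := by
    intro i
    refine boolFun_induction ?_ ?_
    · simp [hρ0, Bool.zero_eq_false]
    · intro j s ih
      rw [hρX, ← mul_assoc, hZX, single_true_add]
      by_cases h : i = j
      · subst h
        rw [if_pos rfl, neg_mul, mul_assoc, ih, Function.update_self]
        cases s i <;> simp [mul_assoc]
      · rw [if_neg h, mul_assoc, ih, Function.update_of_ne h]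
        simp [mul_assoc]
  -- The states in which the first qubits are all `|0⟩`. The image of this space under `ρ s` is the
  -- joint eigenspace with bit string `s`, so an orthonormal basis `b` of it yields the basis `ρ s
  -- (b t)` of the whole space.
  let V₀ : Submodule ℂ V := ⨅ i, eigenspace (Z i) 1
  have hV₀ : ∀ v, v ∈ V₀ ↔ ∀ i, Z i v = v := by
    intro v; simp [V₀, Submodule.mem_iInf]
  have hZv : ∀ i s, ∀ v ∈ V₀, Z i (ρ s v) = (if s i then (-1 : ℂ) else 1) • ρ s v := by
    intro i s v hv
    rw [← Module.End.mul_apply, hZρ, LinearMap.smul_apply, Module.End.mul_apply,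
      (hV₀ v).1 hv i]
  let b := stdOrthonormalBasis ℂ V₀
  let d := Module.finrank ℂ V₀
  let e : (ι → Bool) × Fin d → V := fun p => ρ p.1 (b p.2)
  have he : Orthonormal ℂ e := by
    rw [orthonormal_iff_ite]
    rintro ⟨s, t⟩ ⟨s', t'⟩
    by_cases hs : s = s'
    · subst hs
      have := orthonormal_iff_ite.1 b.orthonormal t t'
      simp only [e, hρinner, Prod.mk.injEq, true_and]
      exact this
    · rw [if_neg (fun h => hs (Prod.ext_iff.1 h).1)]
      obtain ⟨i, hi⟩ := Function.ne_iff.1 hs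
      -- The two vectors have opposite eigenvalues for the self-adjoint operator `Z i`, so they are
      -- orthogonal.
      have h := hZs i (ρ s (b t)) (ρ s' (b t'))
      rw [hZv i s _ (b t).2, hZv i s' _ (b t').2, inner_smul_left, inner_smul_right] at h
      change inner ℂ (ρ s (b t)) (ρ s' (b t')) = 0
      revert h hi
      cases s i <;> cases s' i <;> intro hi h <;> simp at hi h <;> grind
  have hspan : ⊤ ≤ Submodule.span ℂ (Set.range e) := by
    -- Simultaneous diagonalization reduces spanning to joint eigenvectors; one with signs `s` is
    -- carried by `ρ s` into `V₀`, and `ρ s` brings it back.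
    rw [← LinearMap.IsSymmetric.iSup_iInf_eq_top_of_commute hZs (fun i j _ => hZZ i j)]
    refine iSup_le fun χ v hv => ?_
    rw [Submodule.mem_iInf] at hv
    by_cases hv0 : v = 0
    · subst hv0; exact zero_mem _
    let s : ι → Bool := fun i => decide (χ i = -1)
    have hχ : ∀ i, χ i = if s i then -1 else 1 := by
      intro i
      rcases eigenvalue_of_sq_eq_one (hZ i) hv0 (mem_eigenspace_iff.1 (hv i)) with h | h <;>
        simp [s, h]
    have hw : ρ s v ∈ V₀ := by
      rw [hV₀]
      intro i
      rw [← Module.End.mul_apply, hZρ, LinearMap.smul_apply, Module.End.mul_apply,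
        mem_eigenspace_iff.1 (hv i), hχ i, map_smul, smul_smul]
      cases s i <;> simp
    have hmap : (⊤ : Submodule ℂ V₀).map ((ρ s).comp V₀.subtype) ≤
        Submodule.span ℂ (Set.range e) := by
      rw [← b.toBasis.span_eq, Submodule.map_span, Submodule.span_le]
      rintro _ ⟨_, ⟨t, rfl⟩, rfl⟩
      exact Submodule.subset_span ⟨(s, t), by simp [e]⟩
    have := hmap ⟨⟨ρ s v, hw⟩, trivial, rfl⟩
    simpa [hρρ] using this
  let B : OrthonormalBasis ((ι → Bool) × Fin d) ℂ V := OrthonormalBasis.mk he hspan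
  -- The basis has `2 ^ |ι| * d` elements. Once `d` is known, any labelling of the basis of `V₀` by
  -- bit strings serves as the remaining qubits.
  have hd : d = 2 ^ Fintype.card κ := by
    have h1 := Module.finrank_eq_card_basis B.toBasis
    rw [hdim, Fintype.card_prod, Fintype.card_fun, Fintype.card_bool, Fintype.card_fin,
      pow_add] at h1
    exact (Nat.eq_of_mul_eq_mul_left (by positivity) h1).symm
  let ε : Fin d ≃ (κ → Bool) := Fintype.equivOfCardEq (by simp [hd])
  let σ : (ι → Bool) × Fin d ≃ (ι ⊕ κ → Bool) :=
    ((Equiv.refl _).prodCongr ε).trans (Equiv.sumArrowEquivProdArrow ι κ Bool).symm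
  let C := B.reindex σ
  have hC : ∀ s, C s = ρ (fun i => s (Sum.inl i)) (b (ε.symm fun k => s (Sum.inr k))) := by
    intro s
    rw [OrthonormalBasis.reindex_apply]
    simp only [B, OrthonormalBasis.coe_mk]
    rfl
  have hW : ∀ φ : QubitSpace (ι ⊕ κ), C.repr.symm φ = ∑ s, φ s • C s := fun φ =>
    (C.sum_repr_symm φ).symm
  refine ⟨C.repr.symm, ?_, ?_⟩
  · intro i φ
    rw [hW, hW, map_sum]
    let τ : (ι ⊕ κ → Bool) ≃ (ι ⊕ κ → Bool) := Equiv.addLeft (Pi.single (Sum.inl i) true)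
    have hτ : ∀ s, τ s = Function.update s (Sum.inl i) (!(s (Sum.inl i))) :=
      fun s => single_true_add _ _
    rw [← Equiv.sum_comp τ]
    refine Finset.sum_congr rfl fun s _ => ?_
    rw [map_smul]
    have h1 : (pauliX (Sum.inl i) φ) s = φ (τ s) := by rw [hτ]; rfl
    rw [h1, hC, hC, ← Module.End.mul_apply, ← hρX, hτ]
    congr 2
    · congr 1
      rw [single_true_add]
      funext j
      by_cases h : j = i
      · subst h; simp
      · simp [h]
  · intro i φ
    rw [hW, hW, map_sum]
    refine Finset.sum_congr rfl fun s _ => ?_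
    rw [map_smul, hC, hZv _ _ _ (Subtype.mem _), smul_smul]
    congr 1
    exact mul_comm _ _

end QubitStructure

/-! ### Dimension of a joint eigenspace of commuting involutions -/

section JointEigenspace

/-- The value at `A` of the character of `ι → Bool` taking the value `ε i` at the `i`-th
generator. -/
def signChar {ι : Type*} [Fintype ι] (ε : ι → ℤˣ) (A : ι → Bool) : ℂ :=
  ∏ i, if A i then ((ε i : ℤ) : ℂ) else 1

theorem units_cast_mul_self (u : ℤˣ) : ((u : ℤ) : ℂ) * ((u : ℤ) : ℂ) = 1 := by
  rcases Int.units_eq_one_or u with rfl | rfl <;> norm_num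

theorem signChar_zero {ι : Type*} [Fintype ι] (ε : ι → ℤˣ) : signChar ε 0 = 1 := by
  simp [signChar, Bool.zero_eq_false]

theorem signChar_one {ι : Type*} [Fintype ι] (ε : ι → ℤˣ) :
    signChar ε 1 = (((∏ i, ε i : ℤˣ) : ℤ) : ℂ) := by
  simp [signChar, Bool.one_eq_true]

theorem signChar_add {ι : Type*} [Fintype ι] (ε : ι → ℤˣ) (A B : ι → Bool) :
    signChar ε (A + B) = signChar ε A * signChar ε B := by
  simp only [signChar, ← Finset.prod_mul_distrib]
  refine Finset.prod_congr rfl fun i _ => ?_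
  rw [Pi.add_apply, Bool.add_eq_xor]
  cases A i <;> cases B i <;> simp [units_cast_mul_self]

theorem signChar_single {ι : Type*} [Fintype ι] [DecidableEq ι] (ε : ι → ℤˣ) (i : ι) :
    signChar ε (Pi.single i true) = ((ε i : ℤ) : ℂ) := by
  rw [signChar, Finset.prod_eq_single i]
  · simp
  · intro j _ h
    simp [h, Bool.zero_eq_false]
  · simp

theorem signChar_sumElim {ι κ : Type*} [Fintype ι] [Fintype κ] (ε : ι → ℤˣ) (δ : κ → ℤˣ)
    (A : ι → Bool) (B : κ → Bool) :
    signChar (Sum.elim ε δ) (Sum.elim A B) = signChar ε A * signChar δ B := by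
  rw [signChar, Fintype.prod_sum_type]
  rfl

/-- Averaging `signChar ε A • ρ A` over the group gives a projection onto the joint eigenspace, and
the trace of a projection is its rank. No inverse of the character is needed because its values are
signs. -/
theorem mul_finrank_iInf_eigenspace {ι V : Type*} [Fintype ι] [DecidableEq ι] [AddCommGroup V]
    [Module ℂ V] [FiniteDimensional ℂ V] (ρ : (ι → Bool) → Module.End ℂ V) (hρ0 : ρ 0 = 1)
    (hρ : ∀ A B, ρ (A + B) = ρ A * ρ B) (ε : ι → ℤˣ) :
    (2 : ℂ) ^ Fintype.card ι * (Module.finrank ℂ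
        ↥(⨅ i, Module.End.eigenspace (ρ (Pi.single i true)) ((ε i : ℤ) : ℂ)) : ℂ) =
      ∑ A, signChar ε A * LinearMap.trace ℂ V (ρ A) := by
  set E := ⨅ i, Module.End.eigenspace (ρ (Pi.single i true)) ((ε i : ℤ) : ℂ) with hE
  let P : Module.End ℂ V := ((2 : ℂ) ^ Fintype.card ι)⁻¹ • ∑ A, signChar ε A • ρ A
  have hfix : ∀ v ∈ E, ∀ A, ρ A v = signChar ε A • v := by
    intro v hv
    rw [hE, Submodule.mem_iInf] at hv
    refine boolFun_induction ?_ ?_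
    · simp [hρ0, signChar_zero]
    · intro i s ih
      rw [hρ, Module.End.mul_apply, ih, map_smul, Module.End.mem_eigenspace_iff.1 (hv i),
        signChar_add, signChar_single, smul_smul, mul_comm]
  have hP : LinearMap.IsProj E P := by
    constructor
    · intro v
      rw [hE, Submodule.mem_iInf]
      intro i
      rw [Module.End.mem_eigenspace_iff]
      simp only [P, LinearMap.smul_apply, LinearMap.sum_apply, map_smul, map_sum]
      rw [smul_comm]
      congr 1
      -- Translation by the `i`-th generator permutes the group and turns the action of that
      -- generator into the factor `ε i`.
      rw [← Equiv.sum_comp (Equiv.addLeft (Pi.single i true)), Finset.smul_sum]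
      refine Finset.sum_congr rfl fun A _ => ?_
      rw [Equiv.coe_addLeft, hρ, signChar_add, signChar_single, ← Module.End.mul_apply,
        ← mul_assoc, ← hρ, boolFun_add_self, hρ0, one_mul, smul_smul]
    · intro v hv
      simp only [P, LinearMap.smul_apply, LinearMap.sum_apply]
      have : ∀ A : ι → Bool, signChar ε A • ρ A v = v := fun A => by
        rw [hfix v hv, smul_smul, ← signChar_add, boolFun_add_self, signChar_zero, one_smul]
      simp only [this, Finset.sum_const, Finset.card_univ, Fintype.card_fun, Fintype.card_bool]
      rw [← Nat.cast_smul_eq_nsmul ℂ, smul_smul]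
      simp
  have h := hP.trace
  rw [← h]
  simp only [P, map_smul, map_sum, smul_eq_mul]
  rw [mul_inv_cancel_left₀ (pow_ne_zero _ two_ne_zero)]

end JointEigenspace

/-! ### The Pauli group -/

section Pauli

open Matrix

variable {Q : Type} [Fintype Q]

/-- The sign `(-1) ^ b`. -/
def bitSign (b : Bool) : ℂ := if b then -1 else 1

theorem bitSign_add (a b : Bool) : bitSign (a + b) = bitSign a * bitSign b := by
  cases a <;> cases b <;> simp [bitSign, Bool.add_eq_xor]

theorem bitSign_zero : bitSign 0 = 1 := rfl

/-- The product of the Pauli operators `X` over the qubits marked by `a`. -/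
def flipOp (a : Q → Bool) : Module.End ℂ (QubitSpace Q) where
  toFun ψ := WithLp.toLp 2 (fun s => ψ (s + a))
  map_add' _ _ := rfl
  map_smul' _ _ := rfl

/-- The product of the Pauli operators `Z` over the qubits marked by `b`. -/
def phaseOp (b : Q → Bool) : Module.End ℂ (QubitSpace Q) where
  toFun ψ := WithLp.toLp 2 (fun s => bitSign (b ⬝ᵥ s) * ψ s)
  map_add' ψ φ := by ext s; simp [mul_add]
  map_smul' c ψ := by ext s; simp [mul_left_comm]

theorem flipOp_apply (a : Q → Bool) (ψ : QubitSpace Q) (s : Q → Bool) :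
    flipOp a ψ s = ψ (s + a) := rfl

theorem phaseOp_apply (b : Q → Bool) (ψ : QubitSpace Q) (s : Q → Bool) :
    phaseOp b ψ s = bitSign (b ⬝ᵥ s) * ψ s := rfl

theorem pauliX_eq_flipOp [DecidableEq Q] (q : Q) : pauliX q = flipOp (Pi.single q true) := by
  ext ψ s
  rw [flipOp_apply, add_comm, single_true_add]
  rfl

theorem pauliZ_eq_phaseOp [DecidableEq Q] (q : Q) : pauliZ q = phaseOp (Pi.single q true) := by
  ext ψ s
  rw [phaseOp_apply, ← Bool.one_eq_true, single_one_dotProduct]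
  rfl

theorem flipOp_mul (a b : Q → Bool) : flipOp a * flipOp b = flipOp (a + b) := by
  ext ψ s
  simp only [Module.End.mul_apply, flipOp_apply, add_assoc]

theorem phaseOp_mul (a b : Q → Bool) : phaseOp a * phaseOp b = phaseOp (a + b) := by
  ext ψ s
  simp only [Module.End.mul_apply, phaseOp_apply, add_dotProduct, bitSign_add, mul_assoc]

/-- A sign arises for each common qubit, so only the parity of the overlap matters. All commutation
questions thereby become linear algebra over `Bool`. -/
theorem phaseOp_mul_flipOp (a b : Q → Bool) :
    phaseOp b * flipOp a = bitSign (b ⬝ᵥ a) • (flipOp a * phaseOp b) := by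
  ext ψ s
  simp only [Module.End.mul_apply, LinearMap.smul_apply, PiLp.smul_apply, smul_eq_mul,
    flipOp_apply, phaseOp_apply, dotProduct_add, ← mul_assoc]
  rw [← bitSign_add, add_left_comm]
  congr 2
  rw [show b ⬝ᵥ a + b ⬝ᵥ a = 0 from Bool.xor_self _, add_zero]

theorem flipOp_zero : flipOp (0 : Q → Bool) = 1 := by
  ext ψ s
  simp [flipOp_apply]

theorem phaseOp_zero : phaseOp (0 : Q → Bool) = 1 := by
  ext ψ s
  simp [phaseOp_apply, bitSign_zero]

theorem flipOp_isSymmetric [DecidableEq Q] (a : Q → Bool) : (flipOp a).IsSymmetric := by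
  intro φ ψ
  rw [PiLp.inner_apply, PiLp.inner_apply, ← Equiv.sum_comp (Equiv.addRight a)]
  refine Finset.sum_congr rfl fun s _ => ?_
  rw [flipOp_apply, flipOp_apply, Equiv.coe_addRight, add_assoc, boolFun_add_self, add_zero]

theorem phaseOp_isSymmetric [DecidableEq Q] (b : Q → Bool) : (phaseOp b).IsSymmetric := by
  intro φ ψ
  rw [PiLp.inner_apply, PiLp.inner_apply]
  refine Finset.sum_congr rfl fun s _ => ?_
  rw [phaseOp_apply, phaseOp_apply]
  cases b ⬝ᵥ s <;> simp [bitSign]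

/-- Orthogonality of characters: if `b` marks some qubit, flipping the bit there negates every term,
so the sum equals its own negative. -/
theorem sum_bitSign_dotProduct [DecidableEq Q] (b : Q → Bool) :
    ∑ s, bitSign (b ⬝ᵥ s) = if b = 0 then (2 : ℂ) ^ Fintype.card Q else 0 := by
  split_ifs with h
  · simp [h, bitSign_zero]
  · obtain ⟨q, hq⟩ := Function.ne_iff.1 h
    have hq' : b q = true := by simpa [Bool.zero_eq_false] using hq
    have h1 := Equiv.sum_comp (Equiv.addLeft (Pi.single q true)) fun s => bitSign (b ⬝ᵥ s)
    have h2 : b ⬝ᵥ Pi.single q true = true := by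
      rw [← Bool.one_eq_true, dotProduct_single_one, hq']; rfl
    simp only [Equiv.coe_addLeft, dotProduct_add, bitSign_add, h2, ← Finset.mul_sum] at h1
    simp only [bitSign, if_true] at h1 ⊢
    linear_combination (-1 / 2 : ℂ) * h1

/-- A nontrivial flip has no diagonal entries, and without a flip the trace is a character sum. -/
theorem trace_flipOp_mul_phaseOp [DecidableEq Q] (a b : Q → Bool) :
    LinearMap.trace ℂ _ (flipOp a * phaseOp b) =
      if a = 0 ∧ b = 0 then (2 : ℂ) ^ Fintype.card Q else 0 := by
  have h : LinearMap.trace ℂ _ (flipOp a * phaseOp b) =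
      ∑ s, if a = 0 then bitSign (b ⬝ᵥ s) else 0 := by
    rw [LinearMap.trace_eq_sum_inner _ (EuclideanSpace.basisFun _ ℂ)]
    refine Finset.sum_congr rfl fun s _ => ?_
    rw [EuclideanSpace.basisFun_apply, EuclideanSpace.inner_single_left, Module.End.mul_apply,
      flipOp_apply, phaseOp_apply]
    by_cases ha : a = 0
    · simp [ha]
    · simp [ha]
  rw [h]
  by_cases ha : a = 0
  · simp [ha, sum_bitSign_dotProduct]
  · simp [ha]

end Pauli

/-! ### The stabilizers of the subsystem code -/

section Stabilizers

open Matrix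

variable {L : ℕ}

/-- The indicator function of the three qubits of a triangle. -/
def triVec (T : Triangle L) : CodeQubit L → Bool :=
  Pi.single T.vertex true + Pi.single T.hEdge true + Pi.single T.vEdge true

theorem single_true_apply {ι : Type*} [DecidableEq ι] (i j : ι) :
    (Pi.single i true : ι → Bool) j = decide (j = i) := by
  by_cases h : j = i
  · subst h; simp
  · simp [h, Bool.zero_eq_false]

theorem triVec_apply (T : Triangle L) (q : CodeQubit L) :
    triVec T q = decide (q = T.vertex) + decide (q = T.hEdge) + decide (q = T.vEdge) := by
  simp only [triVec, Pi.add_apply, single_true_apply]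

variable (L) in
/-- The rows are the indicator functions of the supports of the stabilizers `S^X_p`. -/
def stabMatX : Matrix (Site L) (CodeQubit L) Bool :=
  Matrix.of fun p => triVec (p, .SW) + triVec (p, .NE)

variable (L) in
/-- The rows are the indicator functions of the supports of the stabilizers `S^Z_p`. -/
def stabMatZ : Matrix (Site L) (CodeQubit L) Bool :=
  Matrix.of fun p => triVec (p, .SE) + triVec (p, .NW)

theorem stabMatX_row (p : Site L) : stabMatX L p = triVec (p, .SW) + triVec (p, .NE) := rfl

theorem stabMatZ_row (p : Site L) : stabMatZ L p = triVec (p, .SE) + triVec (p, .NW) := rfl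

/-- This and the next five lemmas give the columns of the two matrices: each qubit belongs to one
triangle of each of two plaquettes. For `L = 1` the two plaquettes coincide and their contributions
cancel modulo 2, so the formulas still hold. -/
theorem stabMatX_hEdge (r : Site L) : (fun p => stabMatX L p (.hEdge, r)) =
    Pi.single r true + Pi.single (r - (0, 1)) true := by
  obtain ⟨k, l⟩ := r
  funext ⟨i, j⟩
  change triVec _ _ + triVec _ _ = _
  simp only [Pi.add_apply, triVec_apply, single_true_apply, Triangle.vertex, Triangle.hEdge,
    Triangle.vEdge, Prod.mk.injEq, true_and, reduceCtorEq, false_and, decide_false,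
    Bool.add_eq_xor, Bool.xor_false, Bool.false_xor, Prod.mk_sub_mk, eq_sub_iff_add_eq, sub_zero]
  grind

theorem stabMatX_vEdge (r : Site L) : (fun p => stabMatX L p (.vEdge, r)) =
    Pi.single r true + Pi.single (r - (1, 0)) true := by
  obtain ⟨k, l⟩ := r
  funext ⟨i, j⟩
  change triVec _ _ + triVec _ _ = _
  simp only [Pi.add_apply, triVec_apply, single_true_apply, Triangle.vertex, Triangle.hEdge,
    Triangle.vEdge, Prod.mk.injEq, true_and, reduceCtorEq, false_and, decide_false,
    Bool.add_eq_xor, Bool.xor_false, Bool.false_xor, Prod.mk_sub_mk, eq_sub_iff_add_eq, sub_zero]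
  grind

theorem stabMatX_vertex (r : Site L) : (fun p => stabMatX L p (.vertex, r)) =
    Pi.single r true + Pi.single (r - (1, 1)) true := by
  obtain ⟨k, l⟩ := r
  funext ⟨i, j⟩
  change triVec _ _ + triVec _ _ = _
  simp only [Pi.add_apply, triVec_apply, single_true_apply, Triangle.vertex, Triangle.hEdge,
    Triangle.vEdge, Prod.mk.injEq, true_and, reduceCtorEq, false_and, decide_false,
    Bool.add_eq_xor, Bool.xor_false, Prod.mk_sub_mk, eq_sub_iff_add_eq]
  grind

theorem stabMatZ_hEdge (r : Site L) : (fun p => stabMatZ L p (.hEdge, r)) =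
    Pi.single r true + Pi.single (r - (0, 1)) true := by
  obtain ⟨k, l⟩ := r
  funext ⟨i, j⟩
  change triVec _ _ + triVec _ _ = _
  simp only [Pi.add_apply, triVec_apply, single_true_apply, Triangle.vertex, Triangle.hEdge,
    Triangle.vEdge, Prod.mk.injEq, true_and, reduceCtorEq, false_and, decide_false,
    Bool.add_eq_xor, Bool.xor_false, Bool.false_xor, Prod.mk_sub_mk, eq_sub_iff_add_eq, sub_zero]
  grind

theorem stabMatZ_vEdge (r : Site L) : (fun p => stabMatZ L p (.vEdge, r)) =
    Pi.single r true + Pi.single (r - (1, 0)) true := by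
  obtain ⟨k, l⟩ := r
  funext ⟨i, j⟩
  change triVec _ _ + triVec _ _ = _
  simp only [Pi.add_apply, triVec_apply, single_true_apply, Triangle.vertex, Triangle.hEdge,
    Triangle.vEdge, Prod.mk.injEq, true_and, reduceCtorEq, false_and, decide_false,
    Bool.add_eq_xor, Bool.xor_false, Bool.false_xor, Prod.mk_sub_mk, eq_sub_iff_add_eq, sub_zero]
  grind

theorem stabMatZ_vertex (r : Site L) : (fun p => stabMatZ L p (.vertex, r)) =
    Pi.single (r - (1, 0)) true + Pi.single (r - (0, 1)) true := by
  obtain ⟨k, l⟩ := r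
  funext ⟨i, j⟩
  change triVec _ _ + triVec _ _ = _
  simp only [Pi.add_apply, triVec_apply, single_true_apply, Triangle.vertex, Triangle.hEdge,
    Triangle.vEdge, Prod.mk.injEq, true_and, reduceCtorEq, false_and, decide_false,
    Bool.add_eq_xor, Bool.xor_false, Prod.mk_sub_mk, eq_sub_iff_add_eq, sub_zero]
  grind

variable [NeZero L]

/-! ### Commutation relations of the triangle operators -/

theorem triVec_dotProduct (T : Triangle L) (s : CodeQubit L → Bool) :
    triVec T ⬝ᵥ s = s T.vertex + s T.hEdge + s T.vEdge := by
  simp only [triVec, add_dotProduct, ← Bool.one_eq_true, single_one_dotProduct]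

theorem flip_triple (T : Triangle L) :
    pauliX T.vertex * pauliX T.hEdge * pauliX T.vEdge = flipOp (triVec T) := by
  simp only [pauliX_eq_flipOp, flipOp_mul, triVec]

theorem phase_triple (T : Triangle L) :
    pauliZ T.vertex * pauliZ T.hEdge * pauliZ T.vEdge = phaseOp (triVec T) := by
  simp only [pauliZ_eq_phaseOp, phaseOp_mul, triVec]

theorem triangleOp_SW (p : Site L) : triangleOp L (p, .SW) = flipOp (triVec (p, .SW)) :=
  flip_triple _

theorem triangleOp_NE (p : Site L) : triangleOp L (p, .NE) = flipOp (triVec (p, .NE)) :=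
  flip_triple _

theorem triangleOp_SE (p : Site L) : triangleOp L (p, .SE) = phaseOp (triVec (p, .SE)) :=
  phase_triple _

theorem triangleOp_NW (p : Site L) : triangleOp L (p, .NW) = phaseOp (triVec (p, .NW)) :=
  phase_triple _

/-- In this and the three following cases the corner vertices coincide under the same condition as
one kind of edge, so these two contributions cancel. The other kind of edge coincides exactly when
`q = p`. This argument covers small `L` as well. -/
theorem triVec_SE_dot_SW (q p : Site L) :
    triVec (q, .SE) ⬝ᵥ triVec (p, .SW) = decide (q = p) := by
  obtain ⟨i, j⟩ := p
  obtain ⟨k, l⟩ := q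
  simp only [triVec_dotProduct, triVec_apply, Triangle.vertex, Triangle.hEdge, Triangle.vEdge,
    Prod.mk.injEq, true_and, reduceCtorEq, false_and, decide_false, Bool.add_eq_xor,
    Bool.xor_false, Bool.false_xor]
  grind

theorem triVec_SE_dot_NE (q p : Site L) :
    triVec (q, .SE) ⬝ᵥ triVec (p, .NE) = decide (q = p) := by
  obtain ⟨i, j⟩ := p
  obtain ⟨k, l⟩ := q
  simp only [triVec_dotProduct, triVec_apply, Triangle.vertex, Triangle.hEdge, Triangle.vEdge,
    Prod.mk.injEq, true_and, reduceCtorEq, false_and, decide_false, Bool.add_eq_xor,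
    Bool.xor_false, Bool.false_xor, add_left_inj]
  grind

theorem triVec_NW_dot_SW (q p : Site L) :
    triVec (q, .NW) ⬝ᵥ triVec (p, .SW) = decide (q = p) := by
  obtain ⟨i, j⟩ := p
  obtain ⟨k, l⟩ := q
  simp only [triVec_dotProduct, triVec_apply, Triangle.vertex, Triangle.hEdge, Triangle.vEdge,
    Prod.mk.injEq, true_and, reduceCtorEq, false_and, decide_false, Bool.add_eq_xor,
    Bool.xor_false, Bool.false_xor]
  grind

theorem triVec_NW_dot_NE (q p : Site L) :
    triVec (q, .NW) ⬝ᵥ triVec (p, .NE) = decide (q = p) := by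
  obtain ⟨i, j⟩ := p
  obtain ⟨k, l⟩ := q
  simp only [triVec_dotProduct, triVec_apply, Triangle.vertex, Triangle.hEdge, Triangle.vEdge,
    Prod.mk.injEq, true_and, reduceCtorEq, false_and, decide_false, Bool.add_eq_xor,
    Bool.xor_false, Bool.false_xor, add_left_inj]
  grind

theorem stabX_eq (p : Site L) : stabX L p = flipOp (stabMatX L p) := by
  rw [stabX, triangleOp_SW, triangleOp_NE, flipOp_mul]; rfl

theorem stabZ_eq (p : Site L) : stabZ L p = phaseOp (stabMatZ L p) := by
  rw [stabZ, triangleOp_SE, triangleOp_NW, phaseOp_mul]; rfl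

theorem gaugeX_eq (p : Site L) : gaugeX L p = flipOp (triVec (p, .SW)) := triangleOp_SW p

theorem gaugeZ_eq (p : Site L) : gaugeZ L p = phaseOp (triVec (p, .SE)) := triangleOp_SE p

/-- The two triangles of a stabilizer have the same overlap parity with any triangle of the opposite
type, so the parities cancel. -/
theorem triVec_SE_dot_stabX (q p : Site L) : triVec (q, .SE) ⬝ᵥ stabMatX L p = 0 := by
  rw [stabMatX_row, dotProduct_add, triVec_SE_dot_SW, triVec_SE_dot_NE]
  exact Bool.xor_self _

theorem triVec_NW_dot_stabX (q p : Site L) : triVec (q, .NW) ⬝ᵥ stabMatX L p = 0 := by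
  rw [stabMatX_row, dotProduct_add, triVec_NW_dot_SW, triVec_NW_dot_NE]
  exact Bool.xor_self _

theorem stabZ_dot_SW (q p : Site L) : stabMatZ L q ⬝ᵥ triVec (p, .SW) = 0 := by
  rw [stabMatZ_row, add_dotProduct, triVec_SE_dot_SW, triVec_NW_dot_SW]
  exact Bool.xor_self _

theorem stabZ_dot_stabX (q p : Site L) : stabMatZ L q ⬝ᵥ stabMatX L p = 0 := by
  rw [stabMatZ_row, add_dotProduct, triVec_SE_dot_stabX, triVec_NW_dot_stabX]
  rfl

/-! ### Relations among the stabilizers and the dimension of a sector -/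

theorem const_of_sub_one {α : Type*} (f : ZMod L → α) (h : ∀ i, f i = f (i - 1)) (i : ZMod L) :
    f i = f 0 := by
  have hn : ∀ n : ℕ, f (n : ZMod L) = f 0 := by
    intro n
    induction n with
    | zero => simp
    | succ n ih => rw [h, Nat.cast_succ, add_sub_cancel_right, ih]
  have := hn i.val
  rwa [ZMod.natCast_val, ZMod.cast_id] at this

theorem site_const {α : Type*} (A : Site L → α) (h1 : ∀ r, A r = A (r - (1, 0)))
    (h2 : ∀ r, A r = A (r - (0, 1))) (r : Site L) : A r = A 0 := by
  obtain ⟨i, j⟩ := r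
  have e1 := const_of_sub_one (fun i => A (i, j)) (fun i => by
    have := h1 (i, j); rwa [Prod.mk_sub_mk, sub_zero] at this) i
  have e2 := const_of_sub_one (fun j => A (0, j)) (fun j => by
    have := h2 (0, j); rwa [Prod.mk_sub_mk, sub_zero] at this) j
  exact e1.trans e2

theorem dotProduct_single_add_single (A : Site L → Bool) (r r' : Site L) :
    A ⬝ᵥ (Pi.single r true + Pi.single r' true) = A r + A r' := by
  simp only [dotProduct_add, ← Bool.one_eq_true, dotProduct_single_one]

/-- A set of plaquettes covers every qubit an even number of times only if it is empty or
contains all plaquettes. -/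
theorem vecMul_eq_zero_iff (M : Matrix (Site L) (CodeQubit L) Bool) (a b : Site L → Site L)
    (hv : ∀ r, (fun p => M p (.vertex, r)) = Pi.single (a r) true + Pi.single (b r) true)
    (hh : ∀ r, (fun p => M p (.hEdge, r)) = Pi.single r true + Pi.single (r - (0, 1)) true)
    (hw : ∀ r, (fun p => M p (.vEdge, r)) = Pi.single r true + Pi.single (r - (1, 0)) true)
    (A : Site L → Bool) : A ᵥ* M = 0 ↔ A = 0 ∨ A = 1 := by
  constructor
  · intro h
    -- In characteristic 2 a vanishing sum of two bits means equality, so the edge columns alone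
    -- make `A` invariant under both unit translations. The vertex columns enter only in the
    -- converse, where all that matters is that their entries come in pairs; hence `a` and `b` are
    -- arbitrary.
    have key : ∀ x y : Bool, x + y = 0 → x = y := by decide
    have hc := site_const A
      (fun r => key _ _ (by
        rw [← dotProduct_single_add_single, ← hw]; exact congrFun h (.vEdge, r)))
      (fun r => key _ _ (by
        rw [← dotProduct_single_add_single, ← hh]; exact congrFun h (.hEdge, r)))
    cases h0 : A 0 with
    | false => left; funext r; rw [hc, h0]; rfl
    | true => right; funext r; rw [hc, h0]; rfl
  · rintro (rfl | rfl)
    · exact zero_vecMul M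
    · funext ⟨k, r⟩
      cases k
      · change 1 ⬝ᵥ (fun p => M p _) = _
        rw [hv, dotProduct_single_add_single]; rfl
      · change 1 ⬝ᵥ (fun p => M p _) = _
        rw [hh, dotProduct_single_add_single]; rfl
      · change 1 ⬝ᵥ (fun p => M p _) = _
        rw [hw, dotProduct_single_add_single]; rfl

theorem vecMul_stabMatX_eq_zero_iff (A : Site L → Bool) :
    A ᵥ* stabMatX L = 0 ↔ A = 0 ∨ A = 1 :=
  vecMul_eq_zero_iff _ _ _ stabMatX_vertex stabMatX_hEdge stabMatX_vEdge A

theorem vecMul_stabMatZ_eq_zero_iff (A : Site L → Bool) :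
    A ᵥ* stabMatZ L = 0 ↔ A = 0 ∨ A = 1 :=
  vecMul_eq_zero_iff _ _ _ stabMatZ_vertex stabMatZ_hEdge stabMatZ_vEdge A

theorem vecMul_stabMatZ_dot_vecMul_stabMatX (A B : Site L → Bool) :
    (B ᵥ* stabMatZ L) ⬝ᵥ (A ᵥ* stabMatX L) = 0 := by
  have h : stabMatZ L * (stabMatX L)ᵀ = 0 := by
    ext p q
    exact stabZ_dot_stabX p q
  rw [← dotProduct_mulVec, ← mulVec_transpose, mulVec_mulVec, h, zero_mulVec, dotProduct_zero]

/-- Presents each stabilizer as the value at a unit vector of the representation of all bit vectors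
used to compute the dimension of a sector. -/
theorem stabOp_eq (i : Site L ⊕ Site L) :
    Sum.elim (stabX L) (stabZ L) i =
      flipOp ((fun p => (Pi.single i true : Site L ⊕ Site L → Bool) (Sum.inl p)) ᵥ* stabMatX L) *
      phaseOp
        ((fun p => (Pi.single i true : Site L ⊕ Site L → Bool) (Sum.inr p)) ᵥ* stabMatZ L) := by
  have h0 : (fun _ => false : Site L → Bool) = 0 := rfl
  have h1 : ∀ p : Site L, (fun r => decide (r = p)) = Pi.single p (1 : Bool) := fun p => by
    funext r; rw [Bool.one_eq_true, single_true_apply]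
  rcases i with p | p
  · simp only [single_true_apply, Sum.inl.injEq, reduceCtorEq, decide_false, h0, h1,
      zero_vecMul, phaseOp_zero, mul_one, single_one_vecMul]
    exact stabX_eq p
  · simp only [single_true_apply, Sum.inr.injEq, reduceCtorEq, decide_false, h0, h1,
      zero_vecMul, flipOp_zero, one_mul, single_one_vecMul]
    exact stabZ_eq p

theorem sector_eq_iInf (x z : Site L → ℤˣ) :
    sector L x z = ⨅ i : Site L ⊕ Site L, Module.End.eigenspace (Sum.elim (stabX L) (stabZ L) i)
      (((Sum.elim x z i : ℤˣ) : ℤ) : ℂ) := by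
  rw [iInf_sum]
  exact iInf_inf_eq

theorem sum_signChar_const (x : Site L → ℤˣ) {P : (Site L → Bool) → Prop} [DecidablePred P]
    (hP : ∀ A, P A ↔ A = 0 ∨ A = 1) :
    ∑ A, (if P A then signChar x A else 0) = 1 + (((∏ p, x p : ℤˣ) : ℤ) : ℂ) := by
  have h01 : (0 : Site L → Bool) ≠ 1 := fun h => Bool.false_ne_true (congrFun h 0)
  rw [← signChar_zero x, ← signChar_one x, ← Finset.sum_pair h01, ← Finset.sum_filter]
  refine Finset.sum_congr ?_ fun _ _ => rfl
  ext A
  simp [hP]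

theorem card_codeQubit : Fintype.card (CodeQubit L) = 3 * Fintype.card (Site L) := by
  rw [Fintype.card_prod]
  rfl

/-- With `N` plaquettes, the trace formula reads `2 ^ (2N) * dim = 2 ^ (3N) * (1 + ∏ x) * (1 + ∏
z)`. The four surviving terms come from the empty and the full product of the stabilizers of each
type. -/
theorem finrank_sector_eq (x z : Site L → ℤˣ) : (Module.finrank ℂ (sector L x z) : ℂ) =
    2 ^ Fintype.card (Site L) * ((1 + (((∏ p, x p : ℤˣ) : ℤ) : ℂ)) *
      (1 + (((∏ p, z p : ℤˣ) : ℤ) : ℂ))) := by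
  let ρ : (Site L ⊕ Site L → Bool) → Module.End ℂ (CodeSpace L) := fun A =>
    flipOp ((fun p => A (Sum.inl p)) ᵥ* stabMatX L) *
      phaseOp ((fun p => A (Sum.inr p)) ᵥ* stabMatZ L)
  have hρ : ∀ A B, ρ (A + B) = ρ A * ρ B := by
    intro A B
    have e1 : (fun p => (A + B) (Sum.inl p)) = (fun p => A (Sum.inl p)) + fun p => B (Sum.inl p) :=
      rfl
    have e2 : (fun p => (A + B) (Sum.inr p)) = (fun p => A (Sum.inr p)) + fun p => B (Sum.inr p) :=
      rfl
    simp only [ρ]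
    rw [e1, e2, add_vecMul, add_vecMul, ← flipOp_mul, ← phaseOp_mul, mul_assoc, mul_assoc,
      ← mul_assoc (phaseOp _) (flipOp _), phaseOp_mul_flipOp,
      vecMul_stabMatZ_dot_vecMul_stabMatX, bitSign_zero, one_smul, mul_assoc]
  have hρ0 : ρ 0 = 1 := by
    have e : (fun _ => (0 : Bool) : Site L → Bool) = 0 := rfl
    simp only [ρ, Pi.zero_apply, e, zero_vecMul, flipOp_zero, phaseOp_zero, mul_one]
  have h := mul_finrank_iInf_eigenspace ρ hρ0 hρ (Sum.elim x z)
  have hs : (⨅ i, Module.End.eigenspace (ρ (Pi.single i true))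
      (((Sum.elim x z i : ℤˣ) : ℤ) : ℂ)) = sector L x z := by
    rw [sector_eq_iInf]
    refine iInf_congr fun i => ?_
    rw [stabOp_eq]
  rw [hs, Fintype.card_sum, ← Equiv.sum_comp (Equiv.sumArrowEquivProdArrow _ _ Bool).symm,
    Fintype.sum_prod_type] at h
  have hterm : ∀ A B : Site L → Bool,
      signChar (Sum.elim x z) ((Equiv.sumArrowEquivProdArrow _ _ Bool).symm (A, B)) *
        LinearMap.trace ℂ _ (ρ ((Equiv.sumArrowEquivProdArrow _ _ Bool).symm (A, B))) =
      (2 : ℂ) ^ (3 * Fintype.card (Site L)) *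
        ((if A ᵥ* stabMatX L = 0 then signChar x A else 0) *
          (if B ᵥ* stabMatZ L = 0 then signChar z B else 0)) := by
    intro A B
    change signChar (Sum.elim x z) (Sum.elim A B) *
      LinearMap.trace ℂ _ (flipOp (A ᵥ* stabMatX L) * phaseOp (B ᵥ* stabMatZ L)) = _
    rw [signChar_sumElim, trace_flipOp_mul_phaseOp, card_codeQubit]
    by_cases hA : A ᵥ* stabMatX L = 0 <;> by_cases hB : B ᵥ* stabMatZ L = 0 <;>
      simp [hA, hB, mul_comm]
  simp only [hterm, ← Finset.mul_sum, ← Finset.sum_mul] at h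
  rw [sum_signChar_const x vecMul_stabMatX_eq_zero_iff,
    sum_signChar_const z vecMul_stabMatZ_eq_zero_iff] at h
  refine mul_left_cancel₀ (pow_ne_zero (Fintype.card (Site L) + Fintype.card (Site L))
    (two_ne_zero (α := ℂ))) (h.trans ?_)
  ring

theorem sector_ne_bot_iff (x z : Site L → ℤˣ) :
    sector L x z ≠ ⊥ ↔ ∏ p, x p = 1 ∧ ∏ p, z p = 1 := by
  rw [Ne, ← Submodule.finrank_eq_zero (R := ℂ), ← Nat.cast_eq_zero (R := ℂ), finrank_sector_eq]
  rcases Int.units_eq_one_or (∏ p, x p) with hx | hx <;>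
    rcases Int.units_eq_one_or (∏ p, z p) with hz | hz <;> rw [hx, hz] <;> norm_num

theorem finrank_sector {x z : Site L → ℤˣ} (h : sector L x z ≠ ⊥) :
    Module.finrank ℂ (sector L x z) = 2 ^ (Fintype.card (Site L) + 2) := by
  obtain ⟨hx, hz⟩ := (sector_ne_bot_iff x z).1 h
  have := finrank_sector_eq x z
  rw [hx, hz] at this
  rw [← Nat.cast_inj (R := ℂ), this]
  push_cast
  ring

end Stabilizers

/-! ### Gauge qubits and syndrome sectors -/

section Rotation

variable {R : Type*} [Ring R] [Algebra ℂ R]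

/-- Coefficient vectors multiply through their dot product and determinant. So unit vectors give
involutions and perpendicular vectors give anticommuting elements: a rotated Pauli pair is again a
Pauli pair. -/
theorem anticommuting_combo_mul {A B : R} (hA : A * A = 1) (hB : B * B = 1)
    (hBA : B * A = -(A * B)) (a b c d : ℂ) :
    (a • A + b • B) * (c • A + d • B) = (a * c + b * d) • 1 + (a * d - b * c) • (A * B) := by
  simp only [add_mul, mul_add, smul_mul_smul_comm, hA, hB, hBA, smul_neg]
  module

theorem combo_mul_self {A B : R} (hA : A * A = 1) (hB : B * B = 1)
    (hBA : B * A = -(A * B)) {a b : ℂ} (h : a ^ 2 + b ^ 2 = 1) :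
    (a • A + b • B) * (a • A + b • B) = 1 := by
  rw [anticommuting_combo_mul hA hB hBA, mul_comm b a, sub_self, zero_smul, add_zero,
    show a * a + b * b = 1 by linear_combination h, one_smul]

theorem combo_anticommute {A B : R} (hA : A * A = 1) (hB : B * B = 1)
    (hBA : B * A = -(A * B)) (a b : ℂ) :
    (a • A + b • B) * (b • A + (-a) • B) = -((b • A + (-a) • B) * (a • A + b • B)) := by
  rw [anticommuting_combo_mul hA hB hBA, anticommuting_combo_mul hA hB hBA]
  module

theorem combo_commute {A B A' B' : R} (h1 : Commute A A') (h2 : Commute A B') (h3 : Commute B A')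
    (h4 : Commute B B') (a b c d : ℂ) : Commute (a • A + b • B) (c • A' + d • B') :=
  (((h1.smul_right c).add_right (h2.smul_right d)).smul_left a).add_left
    (((h3.smul_right c).add_right (h4.smul_right d)).smul_left b)

end Rotation

section Sectors

open Matrix

variable {L : ℕ} [NeZero L]

theorem isSymmetric_real_combo {V : Type*} [NormedAddCommGroup V] [InnerProductSpace ℂ V]
    {A B : Module.End ℂ V} (hA : A.IsSymmetric) (hB : B.IsSymmetric) (a b : ℝ) :
    ((a : ℂ) • A + (b : ℂ) • B).IsSymmetric :=
  (hA.smul (Complex.conj_ofReal a)).add (hB.smul (Complex.conj_ofReal b))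

theorem flipOp_commute {Q : Type} [Fintype Q] (a b : Q → Bool) :
    Commute (flipOp a) (flipOp b) := by
  rw [commute_iff_eq, flipOp_mul, flipOp_mul, add_comm]

theorem phaseOp_commute {Q : Type} [Fintype Q] (a b : Q → Bool) :
    Commute (phaseOp a) (phaseOp b) := by
  rw [commute_iff_eq, phaseOp_mul, phaseOp_mul, add_comm]

theorem phaseOp_commute_flipOp {Q : Type} [Fintype Q] {a b : Q → Bool} (h : b ⬝ᵥ a = 0) :
    Commute (phaseOp b) (flipOp a) := by
  rw [commute_iff_eq, phaseOp_mul_flipOp, h, bitSign_zero, one_smul]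

theorem flipOp_mul_self {Q : Type} [Fintype Q] (a : Q → Bool) : flipOp a * flipOp a = 1 := by
  rw [flipOp_mul, boolFun_add_self, flipOp_zero]

theorem phaseOp_mul_self {Q : Type} [Fintype Q] (a : Q → Bool) : phaseOp a * phaseOp a = 1 := by
  rw [phaseOp_mul, boolFun_add_self, phaseOp_zero]

/-! ### Symmetry and commutation of the operators of the model -/

theorem triangleOp_isSymmetric (T : Triangle L) : (triangleOp L T).IsSymmetric := by
  rcases T with ⟨p, c⟩
  cases c
  · rw [triangleOp_NW]; exact phaseOp_isSymmetric _
  · rw [triangleOp_NE]; exact flipOp_isSymmetric _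
  · rw [triangleOp_SW]; exact flipOp_isSymmetric _
  · rw [triangleOp_SE]; exact phaseOp_isSymmetric _

theorem hamiltonian_isSymmetric : (hamiltonian L).IsSymmetric := by
  intro φ ψ
  simp only [hamiltonian, LinearMap.neg_apply, LinearMap.sum_apply, inner_neg_left,
    inner_neg_right, sum_inner, inner_sum, triangleOp_isSymmetric _ φ ψ]

theorem gaugeZ_mul_gaugeX (p q : Site L) : gaugeZ L p * gaugeX L q =
    if p = q then -(gaugeX L q * gaugeZ L p) else gaugeX L q * gaugeZ L p := by
  rw [gaugeX_eq, gaugeZ_eq, phaseOp_mul_flipOp, triVec_SE_dot_SW]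
  by_cases h : p = q <;> simp [h, bitSign]

theorem gaugeX_mul_self (p : Site L) : gaugeX L p * gaugeX L p = 1 := by
  rw [gaugeX_eq, flipOp_mul_self]

theorem gaugeZ_mul_self (p : Site L) : gaugeZ L p * gaugeZ L p = 1 := by
  rw [gaugeZ_eq, phaseOp_mul_self]

theorem stabX_commute_gaugeX (p q : Site L) : Commute (stabX L p) (gaugeX L q) := by
  rw [stabX_eq, gaugeX_eq]; exact flipOp_commute _ _

theorem stabX_commute_gaugeZ (p q : Site L) : Commute (stabX L p) (gaugeZ L q) := by
  rw [stabX_eq, gaugeZ_eq]; exact (phaseOp_commute_flipOp (triVec_SE_dot_stabX _ _)).symm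

theorem stabZ_commute_gaugeX (p q : Site L) : Commute (stabZ L p) (gaugeX L q) := by
  rw [stabZ_eq, gaugeX_eq]; exact phaseOp_commute_flipOp (stabZ_dot_SW _ _)

theorem stabZ_commute_gaugeZ (p q : Site L) : Commute (stabZ L p) (gaugeZ L q) := by
  rw [stabZ_eq, gaugeZ_eq]; exact phaseOp_commute _ _

theorem stab_isSymmetric (i : Site L ⊕ Site L) :
    (Sum.elim (stabX L) (stabZ L) i).IsSymmetric := by
  rcases i with p | p
  · rw [Sum.elim_inl, stabX_eq]; exact flipOp_isSymmetric _
  · rw [Sum.elim_inr, stabZ_eq]; exact phaseOp_isSymmetric _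

theorem stab_mul_self (i : Site L ⊕ Site L) :
    Sum.elim (stabX L) (stabZ L) i * Sum.elim (stabX L) (stabZ L) i = 1 := by
  rcases i with p | p
  · rw [Sum.elim_inl, stabX_eq]; exact flipOp_mul_self _
  · rw [Sum.elim_inr, stabZ_eq]; exact phaseOp_mul_self _

theorem stab_commute (i j : Site L ⊕ Site L) :
    Commute (Sum.elim (stabX L) (stabZ L) i) (Sum.elim (stabX L) (stabZ L) j) := by
  rcases i with p | p <;> rcases j with q | q <;>
    simp only [Sum.elim_inl, Sum.elim_inr, stabX_eq, stabZ_eq]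
  · exact flipOp_commute _ _
  · exact (phaseOp_commute_flipOp (stabZ_dot_stabX _ _)).symm
  · exact phaseOp_commute_flipOp (stabZ_dot_stabX _ _)
  · exact phaseOp_commute _ _

/-! ### Sectors as invariant orthogonal summands -/

theorem mem_sector {x z : Site L → ℤˣ} {ψ : CodeSpace L} : ψ ∈ sector L x z ↔
    ∀ p, stabX L p ψ = ((x p : ℤ) : ℂ) • ψ ∧ stabZ L p ψ = ((z p : ℤ) : ℂ) • ψ := by
  simp only [sector, Submodule.mem_iInf, Submodule.mem_inf, Module.End.mem_eigenspace_iff]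

theorem mem_sector_of_commute {A : Module.End ℂ (CodeSpace L)} (hX : ∀ p, Commute (stabX L p) A)
    (hZ : ∀ p, Commute (stabZ L p) A) {x z : Site L → ℤˣ} {ψ : CodeSpace L}
    (hψ : ψ ∈ sector L x z) : A ψ ∈ sector L x z := by
  rw [mem_sector] at hψ ⊢
  intro p
  rw [← Module.End.mul_apply, ← Module.End.mul_apply, (hX p).eq, (hZ p).eq, Module.End.mul_apply,
    Module.End.mul_apply, (hψ p).1, (hψ p).2, map_smul, map_smul]
  exact ⟨rfl, rfl⟩

theorem gaugeX_mem_sector {x z : Site L → ℤˣ} {ψ : CodeSpace L} (hψ : ψ ∈ sector L x z)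
    (p : Site L) : gaugeX L p ψ ∈ sector L x z :=
  mem_sector_of_commute (fun q => stabX_commute_gaugeX q p) (fun q => stabZ_commute_gaugeX q p) hψ

theorem gaugeZ_mem_sector {x z : Site L → ℤˣ} {ψ : CodeSpace L} (hψ : ψ ∈ sector L x z)
    (p : Site L) : gaugeZ L p ψ ∈ sector L x z :=
  mem_sector_of_commute (fun q => stabX_commute_gaugeZ q p) (fun q => stabZ_commute_gaugeZ q p) hψ

theorem hamiltonian_apply_of_mem_sector {x z : Site L → ℤˣ} {ψ : CodeSpace L}
    (hψ : ψ ∈ sector L x z) :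
    hamiltonian L ψ = -∑ p, ((1 + ((x p : ℤ) : ℂ)) • gaugeX L p ψ +
        (1 + ((z p : ℤ) : ℂ)) • gaugeZ L p ψ) := by
  rw [mem_sector] at hψ
  rw [hamiltonian, LinearMap.neg_apply, LinearMap.sum_apply, Fintype.sum_prod_type]
  congr 1
  refine Finset.sum_congr rfl fun p _ => ?_
  -- Since `gaugeX` squares to one, the north-east triangle is `gaugeX` times the stabilizer, whose
  -- value is known in the sector.
  have h1 : triangleOp L (p, .NE) ψ = ((x p : ℤ) : ℂ) • gaugeX L p ψ := by
    rw [← map_smul, ← (hψ p).1, stabX, ← Module.End.mul_apply, ← mul_assoc]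
    change _ = (gaugeX L p * gaugeX L p * _) ψ
    rw [gaugeX_mul_self, one_mul]
  have h2 : triangleOp L (p, .NW) ψ = ((z p : ℤ) : ℂ) • gaugeZ L p ψ := by
    rw [← map_smul, ← (hψ p).2, stabZ, ← Module.End.mul_apply, ← mul_assoc]
    change _ = (gaugeZ L p * gaugeZ L p * _) ψ
    rw [gaugeZ_mul_self, one_mul]
  have hu : (Finset.univ : Finset Corner) = {.NW, .NE, .SW, .SE} := rfl
  rw [hu, Finset.sum_insert (by decide), Finset.sum_insert (by decide), Finset.sum_pair (by decide),
    h1, h2, gaugeX, gaugeZ]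
  module

theorem hamiltonian_mem_sector {x z : Site L → ℤˣ} {ψ : CodeSpace L} (hψ : ψ ∈ sector L x z) :
    hamiltonian L ψ ∈ sector L x z := by
  rw [hamiltonian_apply_of_mem_sector hψ]
  exact neg_mem (sum_mem fun p _ => add_mem (Submodule.smul_mem _ _ (gaugeX_mem_sector hψ p))
    (Submodule.smul_mem _ _ (gaugeZ_mem_sector hψ p)))

/-- Distinct syndromes disagree on some stabilizer, and eigenspaces of a self-adjoint operator for
distinct eigenvalues are orthogonal. -/
theorem orthogonalFamily_sector :
    OrthogonalFamily ℂ (fun s : (Site L → ℤˣ) × (Site L → ℤˣ) => sector L s.1 s.2)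
      (fun s => (sector L s.1 s.2).subtypeₗᵢ) := by
  refine OrthogonalFamily.of_pairwise fun s t hst => ?_
  have hne : Sum.elim s.1 s.2 ≠ Sum.elim t.1 t.2 := fun h => hst
    (Prod.ext (funext fun p => congrFun h (Sum.inl p)) (funext fun p => congrFun h (Sum.inr p)))
  obtain ⟨i, hi⟩ := Function.ne_iff.1 hne
  have hi' : (((Sum.elim s.1 s.2 i : ℤˣ) : ℤ) : ℂ) ≠
      (((Sum.elim t.1 t.2 i : ℤˣ) : ℤ) : ℂ) := fun h =>
    hi (Units.ext (by exact_mod_cast h))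
  have h := (stab_isSymmetric i).orthogonalFamily_eigenspaces.pairwise hi'
  simp only [sector_eq_iInf]
  exact h.mono (iInf_le _ i) (iInf_le _ i)

theorem iSup_sector :
    (⨆ s : (Site L → ℤˣ) × (Site L → ℤˣ), sector L s.1 s.2) = ⊤ := by
  rw [eq_top_iff, ← LinearMap.IsSymmetric.iSup_iInf_eq_top_of_commute
    (stab_isSymmetric (L := L)) (fun i j _ => stab_commute i j)]
  refine iSup_le fun χ v hv => ?_
  rw [Submodule.mem_iInf] at hv
  by_cases hv0 : v = 0
  · subst hv0; exact zero_mem _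
  let u : Site L ⊕ Site L → ℤˣ := fun i => if χ i = 1 then 1 else -1
  have hu : ∀ i, χ i = ((u i : ℤ) : ℂ) := by
    intro i
    rcases eigenvalue_of_sq_eq_one (stab_mul_self i) hv0
      (Module.End.mem_eigenspace_iff.1 (hv i)) with h | h
    · simp [u, h]
    · have : (-1 : ℂ) ≠ 1 := by norm_num
      simp [u, h, this]
  refine Submodule.mem_iSup_of_mem (fun p => u (Sum.inl p), fun p => u (Sum.inr p)) ?_
  rw [mem_sector]
  intro p
  rw [← hu, ← hu]
  exact ⟨Module.End.mem_eigenspace_iff.1 (hv (Sum.inl p)),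
    Module.End.mem_eigenspace_iff.1 (hv (Sum.inr p))⟩

/-- A nonzero sector consists of `L ^ 2 + 2` qubits in such a way that the gauge operators, rotated
by an angle depending on the plaquette, are the Pauli operators of the first `L ^ 2` qubits. -/
theorem exists_rotated_gauge_qubits {x z : Site L → ℤˣ} (h : sector L x z ≠ ⊥) (α β : Site L → ℝ)
    (hαβ : ∀ p, α p ^ 2 + β p ^ 2 = 1) :
    ∃ W : QubitSpace (Site L ⊕ Fin 2) ≃ₗᵢ[ℂ] sector L x z,
      (∀ p φ, ((β p : ℂ) • gaugeX L p + ((-α p : ℝ) : ℂ) • gaugeZ L p) (W φ : CodeSpace L) =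
        W (pauliX (Sum.inl p) φ)) ∧
      (∀ p φ, ((α p : ℂ) • gaugeX L p + (β p : ℂ) • gaugeZ L p) (W φ : CodeSpace L) =
        W (pauliZ (Sum.inl p) φ)) := by
  have hmem : ∀ (a b : ℂ) (p : Site L), ∀ ψ ∈ sector L x z,
      (a • gaugeX L p + b • gaugeZ L p) ψ ∈ sector L x z := fun a b p ψ hψ =>
    add_mem (Submodule.smul_mem _ _ (gaugeX_mem_sector hψ p))
      (Submodule.smul_mem _ _ (gaugeZ_mem_sector hψ p))
  have hanti : ∀ p : Site L, gaugeZ L p * gaugeX L p = -(gaugeX L p * gaugeZ L p) := fun p => by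
    rw [gaugeZ_mul_gaugeX, if_pos rfl]
  have hsymm : ∀ (a b : ℝ) (p : Site L),
      ((a : ℂ) • gaugeX L p + (b : ℂ) • gaugeZ L p).IsSymmetric := fun a b p =>
    isSymmetric_real_combo (triangleOp_isSymmetric _) (triangleOp_isSymmetric _) a b
  have hcomm : ∀ (a b c d : ℂ) (p q : Site L), p ≠ q →
      Commute (a • gaugeX L p + b • gaugeZ L p) (c • gaugeX L q + d • gaugeZ L q) := by
    intro a b c d p q hpq
    refine combo_commute ?_ ?_ ?_ ?_ a b c d
    · rw [gaugeX_eq, gaugeX_eq]; exact flipOp_commute _ _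
    · exact (show gaugeZ L q * gaugeX L p = _ by
        rw [gaugeZ_mul_gaugeX, if_neg hpq.symm]).symm
    · exact show gaugeZ L p * gaugeX L q = _ by rw [gaugeZ_mul_gaugeX, if_neg hpq]
    · rw [gaugeZ_eq, gaugeZ_eq]; exact phaseOp_commute _ _
  have hsq : ∀ p, ((α p : ℝ) : ℂ) ^ 2 + ((β p : ℝ) : ℂ) ^ 2 = 1 := fun p => by
    exact_mod_cast hαβ p
  -- The new `Z` points along the unit vector `(α, β)`, meant to be the field direction, and the new
  -- `X` along the perpendicular `(β, -α)`. The choice `α = 0`, `β = 1` gives back the unrotated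
  -- pair.
  let X : Site L → Module.End ℂ (sector L x z) := fun p =>
    ((β p : ℂ) • gaugeX L p + ((-α p : ℝ) : ℂ) • gaugeZ L p).restrict (hmem _ _ p)
  let Z : Site L → Module.End ℂ (sector L x z) := fun p =>
    ((α p : ℂ) • gaugeX L p + (β p : ℂ) • gaugeZ L p).restrict (hmem _ _ p)
  obtain ⟨W, hX, hZ⟩ := exists_qubit_isometry (κ := Fin 2)
    (V := sector L x z) X Z
    (fun p => (hsymm _ _ p).restrict_invariant _) (fun p => (hsymm _ _ p).restrict_invariant _)
    (fun p => by
      ext1 ψ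
      refine Subtype.ext (LinearMap.congr_fun (combo_mul_self (gaugeX_mul_self p)
        (gaugeZ_mul_self p) (hanti p) ?_) (ψ : CodeSpace L))
      push_cast
      linear_combination hsq p)
    (fun p => by
      ext1 ψ
      exact Subtype.ext (LinearMap.congr_fun (combo_mul_self (gaugeX_mul_self p)
        (gaugeZ_mul_self p) (hanti p) (hsq p)) (ψ : CodeSpace L)))
    (fun p q => by
      by_cases hpq : p = q
      · subst hpq; exact Commute.refl _
      · ext1 ψ
        exact Subtype.ext (LinearMap.congr_fun (hcomm _ _ _ _ p q hpq) (ψ : CodeSpace L)))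
    (fun p q => by
      by_cases hpq : p = q
      · subst hpq; exact Commute.refl _
      · ext1 ψ
        exact Subtype.ext (LinearMap.congr_fun (hcomm _ _ _ _ p q hpq) (ψ : CodeSpace L)))
    (fun p q => by
      by_cases hpq : p = q
      · subst hpq
        rw [if_pos rfl]
        ext1 ψ
        have := combo_anticommute (gaugeX_mul_self p) (gaugeZ_mul_self p) (hanti p) (α p) (β p)
        rw [← Complex.ofReal_neg] at this
        exact Subtype.ext (LinearMap.congr_fun this (ψ : CodeSpace L))
      · rw [if_neg hpq]
        ext1 ψ
        exact Subtype.ext (LinearMap.congr_fun (hcomm _ _ _ _ p q hpq) (ψ : CodeSpace L)))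
    (by rw [finrank_sector h, Fintype.card_fin])
  exact ⟨W, fun p φ => congrArg Subtype.val (hX p φ), fun p φ => congrArg Subtype.val (hZ p φ)⟩

/-- Every eigenvector of an operator preserving the summands of an orthogonal decomposition is a
sum of eigenvectors lying in the summands. -/
theorem eigenspace_le_iSup_inf {ι V : Type*} [Finite ι] [NormedAddCommGroup V]
    [InnerProductSpace ℂ V] [FiniteDimensional ℂ V] {U : ι → Submodule ℂ V}
    (hU : OrthogonalFamily ℂ (fun i => U i) (fun i => (U i).subtypeₗᵢ)) (htop : (⨆ i, U i) = ⊤)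
    {A : Module.End ℂ V} (hA : ∀ i, ∀ v ∈ U i, A v ∈ U i) (μ : ℂ) :
    Module.End.eigenspace A μ ≤ ⨆ i, U i ⊓ Module.End.eigenspace A μ := by
  have := Fintype.ofFinite ι
  classical
  intro ψ hψ
  let F : ι → V := fun i => (U i).starProjection ψ
  have hF : ∀ i, F i ∈ U i := fun i => Submodule.starProjection_apply_mem _ _
  have hsum : ∑ i, F i = ψ :=
    hU.sum_projection_of_mem_iSup ψ (by rw [htop]; trivial)
  -- The vectors `(A - μ) (F i)` lie in mutually orthogonal summands and add up to zero, so each of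
  -- them vanishes.
  have hG : ∀ i, A (F i) - μ • F i ∈ U i := fun i =>
    sub_mem (hA i _ (hF i)) (Submodule.smul_mem _ _ (hF i))
  have hsumG : ∑ i, (A (F i) - μ • F i) = 0 := by
    rw [Finset.sum_sub_distrib, ← map_sum, ← Finset.smul_sum, hsum,
      Module.End.mem_eigenspace_iff.1 hψ, sub_self]
  have hG0 : ∀ i, A (F i) - μ • F i = 0 := by
    intro i
    have h := hU.inner_right_fintype (fun i => ⟨_, hG i⟩) i ⟨_, hG i⟩
    simp only [Submodule.coe_subtypeₗᵢ, Submodule.subtype_apply, hsumG, inner_zero_right] at h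
    have h2 := inner_self_eq_zero.1 h.symm
    exact congrArg Subtype.val h2
  rw [← hsum]
  exact sum_mem fun i _ => Submodule.mem_iSup_of_mem i
    ⟨hF i, Module.End.mem_eigenspace_iff.2 (sub_eq_zero.1 (hG0 i))⟩

theorem eigenspace_le_iSup_sector (μ : ℂ) : Module.End.eigenspace (hamiltonian L) μ ≤
    ⨆ s : (Site L → ℤˣ) × (Site L → ℤˣ),
      sector L s.1 s.2 ⊓ Module.End.eigenspace (hamiltonian L) μ := by
  have h1 := orthogonalFamily_sector (L := L)
  have h2 := iSup_sector (L := L)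
  have h3 := eigenspace_le_iSup_inf (A := hamiltonian L) h1 h2
    (fun s v hv => hamiltonian_mem_sector hv) μ
  intro ψ hψ
  exact h3 hψ

end Sectors

/-! ### Spectrum of one gauge qubit -/

section OneQubit

/-- The largest eigenvalue of a gauge qubit with syndrome `x, z`, in closed form. -/
noncomputable def gaugeEnergy (x z : ℤˣ) : ℝ :=
  if x = 1 then (if z = 1 then 2 * Real.sqrt 2 else 2) else (if z = 1 then 2 else 0)

/-- The `X` component of the unit vector along the field acting on a gauge qubit. -/
noncomputable def gaugeAxisX (x z : ℤˣ) : ℝ :=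
  if x = 1 then (if z = 1 then Real.sqrt 2 / 2 else 1) else 0

/-- The `Z` component of the unit vector along the field acting on a gauge qubit. -/
noncomputable def gaugeAxisZ (x z : ℤˣ) : ℝ :=
  if x = 1 then (if z = 1 then Real.sqrt 2 / 2 else 0) else 1

theorem sq_sqrt_two : Real.sqrt 2 ^ 2 = 2 := Real.sq_sqrt (by norm_num)

theorem neg_one_ne_one_units : (-1 : ℤˣ) ≠ 1 := by decide

/-- For `x = z = -1` there is no field and the axis is by default the `Z` direction; it is a unit
vector even then, so the rotation needs no case distinction. -/
theorem gaugeAxis_sq (x z : ℤˣ) : gaugeAxisX x z ^ 2 + gaugeAxisZ x z ^ 2 = 1 := by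
  have := sq_sqrt_two
  unfold gaugeAxisX gaugeAxisZ
  split_ifs <;> nlinarith

theorem gaugeEnergy_mul_axisX (x z : ℤˣ) :
    gaugeEnergy x z * gaugeAxisX x z = 1 + ((x : ℤ) : ℝ) := by
  have := sq_sqrt_two
  rcases Int.units_eq_one_or x with rfl | rfl <;> rcases Int.units_eq_one_or z with rfl | rfl <;>
    simp only [gaugeEnergy, gaugeAxisX, if_true, if_neg neg_one_ne_one_units, Units.val_one,
      Units.val_neg, Int.cast_one, Int.cast_neg] <;> nlinarith

theorem gaugeEnergy_mul_axisZ (x z : ℤˣ) :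
    gaugeEnergy x z * gaugeAxisZ x z = 1 + ((z : ℤ) : ℝ) := by
  have := sq_sqrt_two
  rcases Int.units_eq_one_or x with rfl | rfl <;> rcases Int.units_eq_one_or z with rfl | rfl <;>
    simp only [gaugeEnergy, gaugeAxisZ, if_true, if_neg neg_one_ne_one_units, Units.val_one,
      Units.val_neg, Int.cast_one, Int.cast_neg] <;> nlinarith

theorem gaugeEnergy_nonneg (x z : ℤˣ) : 0 ≤ gaugeEnergy x z := by
  unfold gaugeEnergy
  split_ifs <;> positivity

/-- The anticommuting involution `K'` exchanges the two eigenspaces of `K`, so one eigenvector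
suffices. For nonzero `v`, either `K v + v` is one, or it vanishes and `v` itself is one. -/
theorem hasEigenvalue_one_and_neg_one {V : Type*} [AddCommGroup V] [Module ℂ V] [Nontrivial V]
    {K K' : Module.End ℂ V} (hK : K * K = 1) (hK' : K' * K' = 1) (h : K * K' = -(K' * K)) :
    K.HasEigenvalue 1 ∧ K.HasEigenvalue (-1) := by
  have hne : ∀ v : V, v ≠ 0 → K' v ≠ 0 := fun v hv h0 => hv (by
    have := LinearMap.congr_fun hK' v
    rw [Module.End.mul_apply, h0, map_zero] at this
    exact this.symm)
  have hswap : ∀ (c : ℂ) (v : V), K v = c • v → K (K' v) = (-c) • K' v := fun c v hv => by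
    rw [← Module.End.mul_apply, h, LinearMap.neg_apply, Module.End.mul_apply, hv, map_smul,
      neg_smul]
  have hpm : ∀ (c : ℂ) (v : V), v ≠ 0 → K v = c • v →
      K.HasEigenvalue c ∧ K.HasEigenvalue (-c) := fun c v hv hc =>
    ⟨Module.End.hasEigenvalue_of_hasEigenvector ⟨Module.End.mem_eigenspace_iff.2 hc, hv⟩,
      Module.End.hasEigenvalue_of_hasEigenvector
        ⟨Module.End.mem_eigenspace_iff.2 (hswap c v hc), hne v hv⟩⟩
  obtain ⟨v, hv⟩ := exists_ne (0 : V)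
  by_cases h0 : K v + v = 0
  · have := hpm (-1) v hv (by rw [neg_one_smul]; exact eq_neg_of_add_eq_zero_left h0)
    rw [neg_neg] at this
    exact this.symm
  · refine hpm 1 _ h0 ?_
    rw [map_add, ← Module.End.mul_apply, hK, one_smul, add_comm]
    rfl

theorem pauliX_mul_self {Q : Type} [Fintype Q] [DecidableEq Q] (q : Q) :
    pauliX q * pauliX q = 1 := by
  rw [pauliX_eq_flipOp, flipOp_mul_self]

theorem pauliZ_mul_self {Q : Type} [Fintype Q] [DecidableEq Q] (q : Q) :
    pauliZ q * pauliZ q = 1 := by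
  rw [pauliZ_eq_phaseOp, phaseOp_mul_self]

theorem pauliZ_mul_pauliX {Q : Type} [Fintype Q] [DecidableEq Q] (q : Q) :
    pauliZ q * pauliX q = -(pauliX q * pauliZ q) := by
  rw [pauliX_eq_flipOp, pauliZ_eq_phaseOp, phaseOp_mul_flipOp]
  simp [← Bool.one_eq_true, bitSign]

theorem gaugeQubitHam_eq (x z : ℤˣ) : gaugeQubitHam x z = (-(gaugeEnergy x z : ℂ)) •
    ((gaugeAxisX x z : ℂ) • pauliX () + (gaugeAxisZ x z : ℂ) • pauliZ ()) := by
  have h1 : (gaugeEnergy x z : ℂ) * gaugeAxisX x z = 1 + ((x : ℤ) : ℂ) := by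
    exact_mod_cast congrArg Complex.ofReal (gaugeEnergy_mul_axisX x z)
  have h2 : (gaugeEnergy x z : ℂ) * gaugeAxisZ x z = 1 + ((z : ℤ) : ℂ) := by
    exact_mod_cast congrArg Complex.ofReal (gaugeEnergy_mul_axisZ x z)
  rw [gaugeQubitHam, ← h1, ← h2]
  module

/-- The Hamiltonian is `-gaugeEnergy x z` times an involution having both signs as eigenvalues. Its
square is scalar, which excludes other levels. -/
theorem gaugeQubitLevels_eq (x z : ℤˣ) :
    gaugeQubitLevels x z = {-gaugeEnergy x z, gaugeEnergy x z} := by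
  have hsq : ((gaugeAxisX x z : ℝ) : ℂ) ^ 2 + ((gaugeAxisZ x z : ℝ) : ℂ) ^ 2 = 1 := by
    exact_mod_cast gaugeAxis_sq x z
  have hanti := combo_anticommute (pauliX_mul_self ()) (pauliZ_mul_self ()) (pauliZ_mul_pauliX ())
    (gaugeAxisX x z : ℂ) (gaugeAxisZ x z : ℂ)
  have hK := combo_mul_self (pauliX_mul_self ()) (pauliZ_mul_self ()) (pauliZ_mul_pauliX ()) hsq
  have hK' := combo_mul_self (pauliX_mul_self ()) (pauliZ_mul_self ()) (pauliZ_mul_pauliX ())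
    (show ((gaugeAxisZ x z : ℝ) : ℂ) ^ 2 + (-((gaugeAxisX x z : ℝ) : ℂ)) ^ 2 = 1 by
      linear_combination hsq)
  have hH := gaugeQubitHam_eq x z
  set K := (gaugeAxisX x z : ℂ) • pauliX () + (gaugeAxisZ x z : ℂ) • pauliZ () with hKdef
  obtain ⟨h1, h2⟩ := hasEigenvalue_one_and_neg_one hK hK' hanti
  have hlevel : ∀ c : ℝ, K.HasEigenvalue (c : ℂ) →
      (gaugeQubitHam x z).HasEigenvalue ((-gaugeEnergy x z * c : ℝ) : ℂ) := by
    intro c hc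
    obtain ⟨v, hv⟩ := hc.exists_hasEigenvector
    refine Module.End.hasEigenvalue_of_hasEigenvector
      ⟨Module.End.mem_eigenspace_iff.2 ?_, hv.2⟩
    rw [hH, LinearMap.smul_apply, hv.apply_eq_smul, smul_smul]
    push_cast
    rfl
  ext μ
  simp only [gaugeQubitLevels, Set.mem_ofPred_eq, Set.mem_insert_iff, Set.mem_singleton_iff]
  constructor
  · intro hμ
    obtain ⟨v, hv⟩ := hμ.exists_hasEigenvector
    have hsq2 : gaugeQubitHam x z (gaugeQubitHam x z v) = ((gaugeEnergy x z : ℂ) ^ 2) • v := by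
      rw [hH, LinearMap.smul_apply, LinearMap.smul_apply, map_smul, ← Module.End.mul_apply, hK,
        smul_smul, Module.End.one_apply]
      congr 1
      ring
    rw [hv.apply_eq_smul, map_smul, hv.apply_eq_smul, smul_smul] at hsq2
    have := smul_left_injective ℂ hv.2 hsq2
    have h3 : μ ^ 2 = gaugeEnergy x z ^ 2 := by
      rw [sq]; exact_mod_cast this
    rcases sq_eq_sq_iff_eq_or_eq_neg.1 h3 with h | h
    · exact Or.inr h
    · exact Or.inl h
  · rintro (rfl | rfl)
    · simpa using hlevel 1 (by simpa using h1)
    · simpa using hlevel (-1) (by simpa using h2)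

theorem isLeast_gaugeQubitLevels (x z : ℤˣ) :
    IsLeast (gaugeQubitLevels x z) (-gaugeEnergy x z) := by
  have := gaugeEnergy_nonneg x z
  rw [gaugeQubitLevels_eq]
  refine ⟨Or.inl rfl, ?_⟩
  rintro _ (rfl | rfl)
  · exact le_rfl
  · linarith

theorem isGreatest_gaugeQubitLevels (x z : ℤˣ) :
    IsGreatest (gaugeQubitLevels x z) (gaugeEnergy x z) := by
  have := gaugeEnergy_nonneg x z
  rw [gaugeQubitLevels_eq]
  refine ⟨Or.inr rfl, ?_⟩
  rintro _ (rfl | rfl)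
  · linarith
  · exact le_rfl

theorem eps0_eq (x z : ℤˣ) : eps0 x z = -gaugeEnergy x z :=
  (isLeast_gaugeQubitLevels x z).csInf_eq

theorem eps1_eq (x z : ℤˣ) : eps1 x z = gaugeEnergy x z :=
  (isGreatest_gaugeQubitLevels x z).csSup_eq

theorem gaugeEnergy_one_one : gaugeEnergy 1 1 = 2 * Real.sqrt 2 := by simp [gaugeEnergy]

theorem gaugeEnergy_one_neg : gaugeEnergy 1 (-1) = 2 := by
  simp [gaugeEnergy]

theorem gaugeEnergy_neg_one : gaugeEnergy (-1) 1 = 2 := by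
  simp [gaugeEnergy]

theorem gaugeEnergy_neg_neg : gaugeEnergy (-1) (-1) = 0 := by
  simp [gaugeEnergy]

end OneQubit

/-! ### Diagonal operators -/

section Diagonal

/-- Multiplication of the amplitudes in the computational basis by given numbers. -/
def diagOp {Q : Type} [Fintype Q] (c : (Q → Bool) → ℂ) : Module.End ℂ (QubitSpace Q) where
  toFun φ := WithLp.toLp 2 (fun s => c s * φ s)
  map_add' ψ φ := by ext s; simp [mul_add]
  map_smul' a ψ := by ext s; simp [mul_left_comm]

theorem diagOp_apply {Q : Type} [Fintype Q] (c : (Q → Bool) → ℂ) (φ : QubitSpace Q)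
    (s : Q → Bool) : diagOp c φ s = c s * φ s := rfl

theorem mem_eigenspace_diagOp {Q : Type} [Fintype Q] {c : (Q → Bool) → ℂ} {μ : ℂ}
    {φ : QubitSpace Q} :
    φ ∈ Module.End.eigenspace (diagOp c) μ ↔ ∀ s, c s ≠ μ → φ s = 0 := by
  rw [Module.End.mem_eigenspace_iff, PiLp.ext_iff]
  refine forall_congr' fun s => ?_
  rw [diagOp_apply, PiLp.smul_apply, smul_eq_mul, mul_eq_mul_right_iff, or_iff_not_imp_left]

/-- Eigenvectors are the amplitude functions supported on the level set of `c`, so the dimension is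
the size of that set. -/
theorem finrank_eigenspace_diagOp {Q : Type} [Fintype Q] (c : (Q → Bool) → ℂ) (μ : ℂ) :
    Module.finrank ℂ (Module.End.eigenspace (diagOp c) μ) = Nat.card {s // c s = μ} := by
  classical
  let e : Module.End.eigenspace (diagOp c) μ ≃ₗ[ℂ] ({s // c s = μ} → ℂ) :=
    { toFun := fun φ s => (φ : QubitSpace Q) s
      map_add' := fun _ _ => rfl
      map_smul' := fun _ _ => rfl
      invFun := fun f => ⟨WithLp.toLp 2 fun s => if h : c s = μ then f ⟨s, h⟩ else 0,
        mem_eigenspace_diagOp.2 fun s hs => dif_neg hs⟩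
      left_inv := by
        intro φ
        ext s
        change (if h : c s = μ then (φ : QubitSpace Q) s else 0) = _
        split_ifs with h
        · rfl
        · exact (mem_eigenspace_diagOp.1 φ.2 s h).symm
      right_inv := by
        intro f
        funext s
        exact dif_pos s.2 }
  rw [e.finrank_eq, Module.finrank_fintype_fun_eq_card, Nat.card_eq_fintype_card]

end Diagonal

/-! ### The spectrum of the Hamiltonian in a sector -/

theorem pairFlip_ne_one {L : ℕ} (p q r : Site L) : pairFlip p q r ≠ 1 ↔ r = p ∨ r = q := by
  unfold pairFlip
  split_ifs with h
  · exact iff_of_true neg_one_ne_one_units h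
  · simp [h]

section Spectrum

variable {L : ℕ} [NeZero L]

theorem exists_gauge_qubits {x z : Site L → ℤˣ} (h : sector L x z ≠ ⊥) :
    ∃ W : QubitSpace (Site L ⊕ Fin 2) ≃ₗᵢ[ℂ] sector L x z,
      (∀ p φ, gaugeX L p (W φ : CodeSpace L) = W (pauliX (Sum.inl p) φ)) ∧
      (∀ p φ, gaugeZ L p (W φ : CodeSpace L) = W (pauliZ (Sum.inl p) φ)) := by
  obtain ⟨W, hX, hZ⟩ := exists_rotated_gauge_qubits h (fun _ => 0) (fun _ => 1) (by simp)
  refine ⟨W, fun p φ => ?_, fun p φ => ?_⟩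
  · simpa using hX p φ
  · simpa using hZ p φ

theorem configEnergy_eq (x z : Site L → ℤˣ) (e : Site L → Bool) :
    configEnergy L x z e = ∑ p, if e p then gaugeEnergy (x p) (z p) else
      -gaugeEnergy (x p) (z p) := by
  simp only [configEnergy, eps0_eq, eps1_eq]

/-- Each Pauli pair is rotated so that its field points along `Z`. The perpendicular combination is
kept because it acts as a bit flip, which creates gauge excitations. -/
theorem exists_diagonalizing_qubits {x z : Site L → ℤˣ} (h : sector L x z ≠ ⊥) :
    ∃ W : QubitSpace (Site L ⊕ Fin 2) ≃ₗᵢ[ℂ] sector L x z,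
      (∀ p φ, ((gaugeAxisZ (x p) (z p) : ℂ) • gaugeX L p +
        ((-gaugeAxisX (x p) (z p) : ℝ) : ℂ) • gaugeZ L p) (W φ : CodeSpace L) =
          W (pauliX (Sum.inl p) φ)) ∧
      (∀ φ, hamiltonian L (W φ : CodeSpace L) =
        W (diagOp (fun s => (configEnergy L x z (fun p => s (Sum.inl p)) : ℂ)) φ)) := by
  obtain ⟨W, hX, hZ⟩ := exists_rotated_gauge_qubits h (fun p => gaugeAxisX (x p) (z p))
    (fun p => gaugeAxisZ (x p) (z p)) (fun p => gaugeAxis_sq _ _)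
  refine ⟨W, hX, fun φ => ?_⟩
  have hterm : ∀ p, (1 + ((x p : ℤ) : ℂ)) • gaugeX L p (W φ : CodeSpace L) +
      (1 + ((z p : ℤ) : ℂ)) • gaugeZ L p (W φ : CodeSpace L) =
      ((W ((gaugeEnergy (x p) (z p) : ℂ) • pauliZ (Sum.inl p) φ) : sector L x z) :
        CodeSpace L) := by
    intro p
    have h1 : (gaugeEnergy (x p) (z p) : ℂ) * gaugeAxisX (x p) (z p) = 1 + ((x p : ℤ) : ℂ) := by
      exact_mod_cast congrArg Complex.ofReal (gaugeEnergy_mul_axisX (x p) (z p))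
    have h2 : (gaugeEnergy (x p) (z p) : ℂ) * gaugeAxisZ (x p) (z p) = 1 + ((z p : ℤ) : ℂ) := by
      exact_mod_cast congrArg Complex.ofReal (gaugeEnergy_mul_axisZ (x p) (z p))
    rw [map_smul, Submodule.coe_smul, ← hZ, ← h1, ← h2, LinearMap.add_apply,
      LinearMap.smul_apply, LinearMap.smul_apply, smul_add, smul_smul, smul_smul]
  rw [hamiltonian_apply_of_mem_sector (W φ).2, Finset.sum_congr rfl fun p _ => hterm p,
    ← Submodule.coe_sum, ← map_sum, ← Submodule.coe_neg, ← map_neg]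
  congr 2
  ext s
  rw [diagOp_apply, PiLp.neg_apply, WithLp.ofLp_sum, Finset.sum_apply, configEnergy_eq]
  push_cast
  rw [Finset.sum_mul, ← Finset.sum_neg_distrib]
  refine Finset.sum_congr rfl fun p _ => ?_
  -- The bit `true` has `Z = -1`; with the overall minus sign of `H` it labels the upper level.
  change -((gaugeEnergy (x p) (z p) : ℂ) * ((if s (Sum.inl p) then (-1 : ℂ) else 1) * φ s)) = _
  cases s (Sum.inl p) <;> simp

/-- The energy ignores the two logical bits, which contribute the factor 4. -/
theorem natCard_qubit_levels (c : (Site L → Bool) → ℂ) (μ : ℂ) :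
    Nat.card {s : Site L ⊕ Fin 2 → Bool // c (fun p => s (Sum.inl p)) = μ} =
      4 * Nat.card {e : Site L → Bool // c e = μ} := by
  let f : {s : Site L ⊕ Fin 2 → Bool // c (fun p => s (Sum.inl p)) = μ} ≃
      (Fin 2 → Bool) × {e : Site L → Bool // c e = μ} :=
    { toFun := fun s => (fun t => s.1 (Sum.inr t), ⟨fun p => s.1 (Sum.inl p), s.2⟩)
      invFun := fun y => ⟨Sum.elim y.2.1 y.1, y.2.2⟩
      left_inv := fun s => Subtype.ext (by funext i; rcases i with i | i <;> rfl)
      right_inv := fun y => rfl }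
  rw [Nat.card_congr f, Nat.card_prod]
  simp

theorem finrank_sector_inf_eigenspace {x z : Site L → ℤˣ} (h : sector L x z ≠ ⊥) (μ : ℂ) :
    Module.finrank ℂ ↥(sector L x z ⊓ Module.End.eigenspace (hamiltonian L) μ) =
      4 * Nat.card {e : Site L → Bool // (configEnergy L x z e : ℂ) = μ} := by
  obtain ⟨W, -, hW⟩ := exists_diagonalizing_qubits h
  let F : QubitSpace (Site L ⊕ Fin 2) →ₗ[ℂ] CodeSpace L :=
    (sector L x z).subtype.comp W.toLinearEquiv.toLinearMap
  have hF : Function.Injective F := Subtype.val_injective.comp W.injective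
  have hmap : sector L x z ⊓ Module.End.eigenspace (hamiltonian L) μ =
      (Module.End.eigenspace
        (diagOp fun s => (configEnergy L x z (fun p => s (Sum.inl p)) : ℂ)) μ).map F := by
    ext ψ
    rw [Submodule.mem_inf, Submodule.mem_map]
    constructor
    · rintro ⟨h1, h2⟩
      obtain ⟨φ, hφ⟩ := W.surjective ⟨ψ, h1⟩
      have hφ' : F φ = ψ := congrArg Subtype.val hφ
      refine ⟨φ, Module.End.mem_eigenspace_iff.2 (hF ?_), hφ'⟩
      rw [map_smul, hφ', ← Module.End.mem_eigenspace_iff.1 h2, ← hφ']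
      exact (hW φ).symm
    · rintro ⟨φ, hφ, rfl⟩
      refine ⟨(W φ).2, Module.End.mem_eigenspace_iff.2 ?_⟩
      rw [← map_smul, ← Module.End.mem_eigenspace_iff.1 hφ]
      exact hW φ
  rw [hmap, (Submodule.equivMapOfInjective F hF _).finrank_eq.symm, finrank_eigenspace_diagOp,
    natCard_qubit_levels fun e => (configEnergy L x z e : ℂ)]

theorem mem_sectorLevels_iff {x z : Site L → ℤˣ} (h : sector L x z ≠ ⊥) (μ : ℝ) :
    μ ∈ sectorLevels L x z ↔ ∃ e, configEnergy L x z e = μ := by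
  have h1 : μ ∈ sectorLevels L x z ↔
      sector L x z ⊓ Module.End.eigenspace (hamiltonian L) (μ : ℂ) ≠ ⊥ := by
    rw [Submodule.ne_bot_iff]
    constructor
    · rintro ⟨ψ, h1, h2, h3⟩
      exact ⟨ψ, ⟨h1, Module.End.mem_eigenspace_iff.2 h3⟩, h2⟩
    · rintro ⟨ψ, ⟨h1, h3⟩, h2⟩
      exact ⟨ψ, h1, h2, Module.End.mem_eigenspace_iff.1 h3⟩
  rw [h1, Ne, ← Submodule.finrank_eq_zero (R := ℂ), finrank_sector_inf_eigenspace h,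
    Nat.mul_eq_zero, not_or, Nat.card_eq_zero, not_or, not_isEmpty_iff, nonempty_subtype]
  simp only [Complex.ofReal_inj]
  -- `Nat.card` also vanishes on infinite types, so finiteness of the set of configurations has to
  -- be supplied.
  exact ⟨fun h => h.2.1, fun h => ⟨by norm_num, h, not_infinite_iff_finite.2 inferInstance⟩⟩

/-! ### Lowest energies -/

theorem card_site : (Fintype.card (Site L) : ℝ) = (L : ℝ) ^ 2 := by
  rw [Fintype.card_prod, ZMod.card]
  push_cast
  ring

theorem gaugeEnergy_eq_defect (x z : ℤˣ) : -gaugeEnergy x z = -2 * Real.sqrt 2 +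
    2 * (Real.sqrt 2 - 1) * (if x ≠ z then 1 else 0) +
    2 * Real.sqrt 2 * (if x = -1 ∧ z = -1 then 1 else 0) := by
  have h1 : (1 : ℤˣ) ≠ -1 := by decide
  have h2 : (-1 : ℤˣ) ≠ 1 := by decide
  rcases Int.units_eq_one_or x with rfl | rfl <;> rcases Int.units_eq_one_or z with rfl | rfl <;>
    simp only [gaugeEnergy, h1, h2, ne_eq, not_true, not_false_iff, if_true, if_false,
      and_true, and_false, and_self] <;> ring

theorem sum_neg_gaugeEnergy (x z : Site L → ℤˣ) :
    ∑ p, -gaugeEnergy (x p) (z p) = groundEnergy L +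
      2 * (Real.sqrt 2 - 1) * (Finset.univ.filter (fun p => x p ≠ z p)).card +
      2 * Real.sqrt 2 * (Finset.univ.filter (fun p => x p = -1 ∧ z p = -1)).card := by
  simp only [gaugeEnergy_eq_defect, Finset.sum_add_distrib, ← Finset.mul_sum, Finset.sum_boole,
    Finset.sum_const, Finset.card_univ, nsmul_eq_mul, card_site, groundEnergy]
  ring

theorem le_configEnergy (x z : Site L → ℤˣ) (e : Site L → Bool) :
    ∑ p, -gaugeEnergy (x p) (z p) ≤ configEnergy L x z e := by
  rw [configEnergy_eq]
  refine Finset.sum_le_sum fun p _ => ?_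
  have := gaugeEnergy_nonneg (x p) (z p)
  split_ifs <;> linarith

theorem isLeast_sectorLevels {x z : Site L → ℤˣ} (h : sector L x z ≠ ⊥) :
    IsLeast (sectorLevels L x z) (groundEnergy L +
      2 * (Real.sqrt 2 - 1) * (Finset.univ.filter (fun p => x p ≠ z p)).card +
      2 * Real.sqrt 2 * (Finset.univ.filter (fun p => x p = -1 ∧ z p = -1)).card) := by
  rw [← sum_neg_gaugeEnergy]
  constructor
  · rw [mem_sectorLevels_iff h]
    exact ⟨fun _ => false, by simp [configEnergy_eq]⟩
  · intro μ hμ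
    obtain ⟨e, rfl⟩ := (mem_sectorLevels_iff h μ).1 hμ
    exact le_configEnergy x z e

theorem sector_one_one_ne_bot : sector L 1 1 ≠ ⊥ := by
  rw [sector_ne_bot_iff]
  simp

theorem configEnergy_one_one (e : Site L → Bool) : configEnergy L 1 1 e = groundEnergy L +
    4 * Real.sqrt 2 * (Finset.univ.filter (fun p => e p = true)).card := by
  have h : ∀ p, (if e p then gaugeEnergy 1 1 else -gaugeEnergy 1 1) =
      -2 * Real.sqrt 2 + 4 * Real.sqrt 2 * (if e p = true then 1 else 0) := by
    intro p
    rw [gaugeEnergy_one_one]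
    split_ifs <;> ring
  simp only [configEnergy_eq, Pi.one_apply, h, Finset.sum_add_distrib, ← Finset.mul_sum,
    Finset.sum_boole, Finset.sum_const, Finset.card_univ, nsmul_eq_mul, card_site, groundEnergy]
  ring

theorem natCard_bool_fun_filter {ι : Type*} [Fintype ι] (k : ℕ) :
    Nat.card {e : ι → Bool // (Finset.univ.filter (fun p => e p = true)).card = k} =
      (Fintype.card ι).choose k := by
  classical
  let f : {e : ι → Bool // (Finset.univ.filter (fun p => e p = true)).card = k} ≃
      {s : Finset ι // s.card = k} :=
    { toFun := fun e => ⟨Finset.univ.filter (fun p => e.1 p = true), e.2⟩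
      invFun := fun s => ⟨fun p => decide (p ∈ s.1), by simpa using s.2⟩
      left_inv := fun e => by ext p; simp
      right_inv := fun s => by ext p; simp }
  rw [Nat.card_congr f, Nat.card_eq_fintype_card, Fintype.card_finset_len]

theorem finrank_trivial_sector_level (k : ℕ) :
    Module.finrank ℂ ↥(sector L 1 1 ⊓ Module.End.eigenspace (hamiltonian L)
      ((groundEnergy L + 4 * Real.sqrt 2 * k : ℝ) : ℂ)) = 4 * (L ^ 2).choose k := by
  have h2 : (4 * Real.sqrt 2 : ℝ) ≠ 0 := by positivity
  rw [finrank_sector_inf_eigenspace sector_one_one_ne_bot]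
  simp only [Complex.ofReal_inj, configEnergy_one_one, add_right_inj, mul_right_inj' h2,
    Nat.cast_inj]
  rw [natCard_bool_fun_filter, Fintype.card_prod, ZMod.card, sq]

theorem even_card_neg_one {ι : Type*} [Fintype ι] {x : ι → ℤˣ} (h : ∏ p, x p = 1) :
    Even (Finset.univ.filter (fun p => x p = -1)).card := by
  have h1 : ∏ p, x p = ∏ p, (if x p = -1 then (-1 : ℤˣ) else 1) := by
    refine Finset.prod_congr rfl fun p _ => ?_
    rcases Int.units_eq_one_or (x p) with hp | hp <;> rw [hp] <;> decide
  rw [h1, Finset.prod_ite, Finset.prod_const, Finset.prod_const_one, mul_one] at h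
  exact (neg_one_pow_eq_one_iff_even (by decide)).1 h

/-! ### The ground level and the gap -/

theorem exists_sector_of_mem_energyLevels {μ : ℝ} (hμ : μ ∈ energyLevels L) :
    ∃ x z : Site L → ℤˣ, sector L x z ≠ ⊥ ∧ μ ∈ sectorLevels L x z := by
  by_contra! hcon
  refine hμ (eq_bot_iff.2 ((eigenspace_le_iSup_sector _).trans (iSup_le fun s => ?_)))
  rintro ψ ⟨h1, h2⟩
  by_contra h0
  have hne : sector L s.1 s.2 ≠ ⊥ := (Submodule.ne_bot_iff _).2 ⟨ψ, h1, h0⟩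
  exact hcon s.1 s.2 hne ⟨ψ, h1, h0, Module.End.mem_eigenspace_iff.1 h2⟩

theorem mem_energyLevels_of_mem_sectorLevels {x z : Site L → ℤˣ} {μ : ℝ}
    (h : μ ∈ sectorLevels L x z) : μ ∈ energyLevels L := by
  obtain ⟨ψ, -, h2, h3⟩ := h
  exact Module.End.hasEigenvalue_of_hasEigenvector ⟨Module.End.mem_eigenspace_iff.2 h3, h2⟩

theorem one_lt_sqrt_two : 1 < Real.sqrt 2 := by
  rw [Real.lt_sqrt] <;> norm_num

/-- Let `n₁` and `n₂` count the plaquettes with one and with two flips. Then `n₁ + 2 n₂` is the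
total number of flips, even and positive. The excess over the claimed bound is `2(√2 - 1)(n₁ + 2 n₂
- 2) + 2(2 - √2) n₂`, a sum of nonnegative terms. -/
theorem sectorLevels_gap {x z : Site L → ℤˣ} (h : sector L x z ≠ ⊥) (hxz : (x, z) ≠ (1, 1))
    {μ : ℝ} (hμ : μ ∈ sectorLevels L x z) : groundEnergy L + 4 * (Real.sqrt 2 - 1) ≤ μ := by
  refine le_trans ?_ ((isLeast_sectorLevels h).2 hμ)
  obtain ⟨hx, hz⟩ := (sector_ne_bot_iff x z).1 h
  obtain ⟨a, ha⟩ := even_card_neg_one hx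
  obtain ⟨b, hb⟩ := even_card_neg_one hz
  have hcount : (Finset.univ.filter (fun p => x p ≠ z p)).card +
      2 * (Finset.univ.filter (fun p => x p = -1 ∧ z p = -1)).card =
      (Finset.univ.filter (fun p => x p = -1)).card +
        (Finset.univ.filter (fun p => z p = -1)).card := by
    simp only [Finset.card_filter, Finset.mul_sum, ← Finset.sum_add_distrib]
    refine Finset.sum_congr rfl fun p _ => ?_
    rcases Int.units_eq_one_or (x p) with hp | hp <;>
      rcases Int.units_eq_one_or (z p) with hq | hq <;> rw [hp, hq] <;> decide
  have hpos : 0 < (Finset.univ.filter (fun p => x p = -1)).card +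
      (Finset.univ.filter (fun p => z p = -1)).card := by
    by_contra h0
    have hx0 : (Finset.univ.filter (fun p => x p = -1)).card = 0 := by omega
    have hz0 : (Finset.univ.filter (fun p => z p = -1)).card = 0 := by omega
    rw [Finset.card_eq_zero, Finset.filter_eq_empty_iff] at hx0 hz0
    refine hxz (Prod.ext (funext fun p => ?_) (funext fun p => ?_))
    · exact (Int.units_eq_one_or (x p)).resolve_right (hx0 (Finset.mem_univ p))
    · exact (Int.units_eq_one_or (z p)).resolve_right (hz0 (Finset.mem_univ p))
  have h2 : 2 ≤ (Finset.univ.filter (fun p => x p ≠ z p)).card +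
      2 * (Finset.univ.filter (fun p => x p = -1 ∧ z p = -1)).card := by omega
  have h2' : (2 : ℝ) ≤ ((Finset.univ.filter (fun p => x p ≠ z p)).card : ℝ) +
      2 * ((Finset.univ.filter (fun p => x p = -1 ∧ z p = -1)).card : ℝ) := by
    exact_mod_cast h2
  have hs := one_lt_sqrt_two
  have hs2 : Real.sqrt 2 < 2 := by nlinarith [sq_sqrt_two]
  have hn : (0 : ℝ) ≤ ((Finset.univ.filter (fun p => x p = -1 ∧ z p = -1)).card : ℝ) :=
    Nat.cast_nonneg _
  nlinarith [mul_le_mul_of_nonneg_left h2' (sub_nonneg.2 hs.le),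
    mul_nonneg hn (sub_nonneg.2 hs2.le)]

theorem energyLevels_gap {μ : ℝ} (hμ : μ ∈ energyLevels L) (hne : μ ≠ groundEnergy L) :
    groundEnergy L + 4 * (Real.sqrt 2 - 1) ≤ μ := by
  obtain ⟨x, z, h, hxz⟩ := exists_sector_of_mem_energyLevels hμ
  by_cases h1 : (x, z) = (1, 1)
  · obtain ⟨rfl, rfl⟩ := Prod.mk.inj h1
    obtain ⟨e, rfl⟩ := (mem_sectorLevels_iff h μ).1 hxz
    rw [configEnergy_one_one] at hne ⊢
    have hk : (Finset.univ.filter (fun p => e p = true)).card ≠ 0 := by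
      intro h0
      rw [h0] at hne
      simp at hne
    have hk' : (1 : ℝ) ≤ ((Finset.univ.filter (fun p => e p = true)).card : ℝ) := by
      exact_mod_cast Nat.one_le_iff_ne_zero.2 hk
    nlinarith [one_lt_sqrt_two]
  · exact sectorLevels_gap h h1 hxz

theorem groundEnergy_mem_sectorLevels : groundEnergy L ∈ sectorLevels L 1 1 := by
  rw [mem_sectorLevels_iff sector_one_one_ne_bot]
  exact ⟨fun _ => false, by simp [configEnergy_one_one]⟩

theorem isLeast_energyLevels : IsLeast (energyLevels L) (groundEnergy L) := by
  refine ⟨mem_energyLevels_of_mem_sectorLevels groundEnergy_mem_sectorLevels, fun μ hμ => ?_⟩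
  by_cases h : μ = groundEnergy L
  · exact h.ge
  · linarith [energyLevels_gap hμ h, one_lt_sqrt_two]

/-- A ground state splits into eigenvectors inside the sectors, and a nonzero component in a
nontrivial sector would violate the gap. -/
theorem ground_eigenspace_le : Module.End.eigenspace (hamiltonian L) (groundEnergy L : ℂ) ≤
    sector L 1 1 := by
  refine (eigenspace_le_iSup_sector _).trans (iSup_le fun s => ?_)
  rintro ψ ⟨h1, h2⟩
  by_cases hs : (s.1, s.2) = (1, 1)
  · obtain ⟨e1, e2⟩ := Prod.mk.inj hs
    rwa [e1, e2] at h1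
  · by_cases h0 : ψ = 0
    · rw [h0]; exact zero_mem _
    · have hne : sector L s.1 s.2 ≠ ⊥ := (Submodule.ne_bot_iff _).2 ⟨ψ, h1, h0⟩
      have := sectorLevels_gap hne hs (μ := groundEnergy L)
        ⟨ψ, h1, h0, Module.End.mem_eigenspace_iff.1 h2⟩
      linarith [one_lt_sqrt_two]

theorem finrank_ground_eigenspace :
    Module.finrank ℂ (Module.End.eigenspace (hamiltonian L) (groundEnergy L : ℂ)) = 4 := by
  have h := finrank_trivial_sector_level (L := L) 0
  rw [Nat.cast_zero, mul_zero, add_zero, inf_eq_right.2 ground_eigenspace_le] at h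
  simpa using h

/-- In the diagonalizing qubits this operator is the Pauli `X` of qubit `p`, an isometry. Ground
states are supported on strings whose gauge bits all vanish, and the flip moves this support to
strings with the single gauge bit `p`. -/
theorem gauge_excitation (p : Site L) {ψ : CodeSpace L}
    (hψ : ψ ∈ Module.End.eigenspace (hamiltonian L) (groundEnergy L : ℂ)) :
    ‖((gaugeAxisZ 1 1 : ℂ) • gaugeX L p + ((-gaugeAxisX 1 1 : ℝ) : ℂ) • gaugeZ L p) ψ‖ = ‖ψ‖ ∧
    ((gaugeAxisZ 1 1 : ℂ) • gaugeX L p + ((-gaugeAxisX 1 1 : ℝ) : ℂ) • gaugeZ L p) ψ ∈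
      sector L 1 1 ⊓ Module.End.eigenspace (hamiltonian L)
        ((groundEnergy L + 4 * Real.sqrt 2 : ℝ) : ℂ) := by
  obtain ⟨W, hX, hW⟩ := exists_diagonalizing_qubits (sector_one_one_ne_bot (L := L))
  obtain ⟨φ, hφ⟩ := W.surjective ⟨ψ, ground_eigenspace_le hψ⟩
  obtain rfl : (W φ : CodeSpace L) = ψ := congrArg Subtype.val hφ
  have hground : φ ∈ Module.End.eigenspace (diagOp fun s : Site L ⊕ Fin 2 → Bool =>
      (configEnergy L 1 1 (fun p => s (Sum.inl p)) : ℂ)) (groundEnergy L : ℂ) := by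
    rw [Module.End.mem_eigenspace_iff] at hψ ⊢
    refine W.injective (Subtype.ext ?_)
    rw [← hW, hψ, map_smul, Submodule.coe_smul]
  rw [mem_eigenspace_diagOp] at hground
  have hp : ((gaugeAxisZ 1 1 : ℂ) • gaugeX L p + ((-gaugeAxisX 1 1 : ℝ) : ℂ) • gaugeZ L p)
      (W φ : CodeSpace L) = W (pauliX (Sum.inl p) φ) := hX p φ
  have hsymm : (pauliX (Sum.inl p : Site L ⊕ Fin 2)).IsSymmetric := by
    rw [pauliX_eq_flipOp]; exact flipOp_isSymmetric _
  have hnorm : ‖pauliX (Sum.inl p : Site L ⊕ Fin 2) φ‖ = ‖φ‖ := by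
    rw [norm_eq_sqrt_re_inner (𝕜 := ℂ), norm_eq_sqrt_re_inner (𝕜 := ℂ) φ, hsymm,
      ← Module.End.mul_apply, pauliX_mul_self, Module.End.one_apply]
  refine ⟨?_, ?_⟩
  · rw [hp]
    exact (W.norm_map _).trans (hnorm.trans (W.norm_map φ).symm)
  · rw [hp]
    refine ⟨Subtype.mem _, Module.End.mem_eigenspace_iff.2 ?_⟩
    rw [hW, ← Submodule.coe_smul, ← map_smul]
    congr 2
    rw [← Module.End.mem_eigenspace_iff, mem_eigenspace_diagOp]
    intro s hs
    -- Contrapositively, a nonzero amplitude at `s` after the flip requires the string with bit `p`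
    -- flipped back to have ground energy.
    refine hground (Function.update s (Sum.inl p) (!(s (Sum.inl p)))) fun hE => hs ?_
    rw [Complex.ofReal_inj, configEnergy_one_one] at hE ⊢
    have h0 : (Finset.univ.filter fun q : Site L =>
        Function.update s (Sum.inl p) (!(s (Sum.inl p))) (Sum.inl q) = true).card = 0 := by
      have h4 : (4 * Real.sqrt 2 : ℝ) ≠ 0 := by positivity
      have := (mul_eq_zero.1 (add_eq_left.1 hE)).resolve_left h4
      exact_mod_cast this
    rw [Finset.card_eq_zero, Finset.filter_eq_empty_iff] at h0
    have h1 : (Finset.univ.filter fun q : Site L => s (Sum.inl q) = true) = {p} := by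
      ext q
      have hq := h0 (Finset.mem_univ q)
      rw [Finset.mem_filter, Finset.mem_singleton]
      by_cases hqp : q = p
      · subst hqp
        simpa using hq
      · rw [Function.update_of_ne (by simpa using hqp)] at hq
        simp [hq, hqp]
    rw [h1]
    simp

/-! ### Pairs of flipped syndrome bits -/

theorem prod_pairFlip {p q : Site L} (hpq : p ≠ q) : ∏ r, pairFlip p q r = 1 := by
  have h : (Finset.univ.filter fun r : Site L => r = p ∨ r = q) = {p, q} := by
    ext r; simp
  simp only [pairFlip]
  rw [Finset.prod_ite, Finset.prod_const, h, Finset.card_pair hpq]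
  simp

theorem card_pairFlip_ne_one {p q : Site L} (hpq : p ≠ q) :
    (Finset.univ.filter (fun r => pairFlip p q r ≠ (1 : Site L → ℤˣ) r)).card = 2 := by
  rw [← Finset.card_pair hpq]
  congr 1
  ext r
  simp [pairFlip_ne_one]

theorem isLeast_sectorLevels_pairFlip {p q : Site L} (hpq : p ≠ q) :
    IsLeast (sectorLevels L (pairFlip p q) 1)
      (groundEnergy L + 2 * (2 * (Real.sqrt 2 - 1))) ∧
    IsLeast (sectorLevels L 1 (pairFlip p q))
      (groundEnergy L + 2 * (2 * (Real.sqrt 2 - 1))) := by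
  have h1 : sector L (pairFlip p q) 1 ≠ ⊥ :=
    (sector_ne_bot_iff _ _).2 ⟨prod_pairFlip hpq, by simp⟩
  have h2 : sector L 1 (pairFlip p q) ≠ ⊥ :=
    (sector_ne_bot_iff _ _).2 ⟨by simp, prod_pairFlip hpq⟩
  have hne : (1 : ℤˣ) ≠ -1 := neg_one_ne_one_units.symm
  have c1 := card_pairFlip_ne_one hpq
  have c2 : (Finset.univ.filter (fun r => (1 : Site L → ℤˣ) r ≠ pairFlip p q r)).card = 2 := by
    simpa only [ne_comm] using c1
  constructor
  · convert isLeast_sectorLevels h1 using 1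
    rw [c1]
    simp only [Pi.one_apply, hne, and_false, Finset.filter_false, Finset.card_empty]
    push_cast
    ring
  · convert isLeast_sectorLevels h2 using 1
    rw [c2]
    simp only [Pi.one_apply, hne, false_and, Finset.filter_false, Finset.card_empty]
    push_cast
    ring

theorem isLeast_energyLevels_above_ground (hL : 2 ≤ L) :
    IsLeast {μ ∈ energyLevels L | groundEnergy L < μ}
      (groundEnergy L + 4 * (Real.sqrt 2 - 1)) := by
  have : Fact (1 < L) := ⟨hL⟩
  -- Here `2 ≤ L` provides two distinct plaquettes. For `L = 1` there is only one, and parity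
  -- forbids any flip.
  have hpq : ((0, 0) : Site L) ≠ (1, 0) := fun h => zero_ne_one (Prod.ext_iff.1 h).1
  refine ⟨⟨?_, by linarith [one_lt_sqrt_two]⟩, fun μ hμ => energyLevels_gap hμ.1 hμ.2.ne'⟩
  have h := mem_energyLevels_of_mem_sectorLevels (isLeast_sectorLevels_pairFlip hpq).1.1
  convert h using 1
  ring

end Spectrum

theorem mainTheorem2 (L : ℕ) [NeZero L] :
    -- `H` is self-adjoint, and the space is the orthogonal sum of the syndrome sectors
    (hamiltonian L).IsSymmetric ∧
    OrthogonalFamily ℂ (fun s : (Site L → ℤˣ) × (Site L → ℤˣ) => sector L s.1 s.2)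
      (fun s => (sector L s.1 s.2).subtypeₗᵢ) ∧
    (⨆ s : (Site L → ℤˣ) × (Site L → ℤˣ), sector L s.1 s.2) = ⊤ ∧
    -- constraints on the syndrome: excitations of either type come in pairs
    (∀ x z : Site L → ℤˣ, sector L x z ≠ ⊥ ↔ (∏ p, x p = 1 ∧ ∏ p, z p = 1)) ∧
    (∀ x z : Site L → ℤˣ, sector L x z ≠ ⊥ →
      Even (Finset.univ.filter (fun p => x p = -1)).card ∧
      Even (Finset.univ.filter (fun p => z p = -1)).card) ∧
    -- the restriction of `H` to a sector
    (∀ x z : Site L → ℤˣ, ∀ ψ ∈ sector L x z,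
      hamiltonian L ψ = -∑ p, ((1 + ((x p : ℤ) : ℂ)) • gaugeX L p ψ +
        (1 + ((z p : ℤ) : ℂ)) • gaugeZ L p ψ)) ∧
    -- each nonzero sector consists of `L ^ 2` independent gauge qubits, on which `H` acts as a sum
    -- of one-qubit terms, and two further qubits, on which `H` acts trivially
    (∀ x z : Site L → ℤˣ, sector L x z ≠ ⊥ →
      ∃ W : QubitSpace (Site L ⊕ Fin 2) ≃ₗᵢ[ℂ] sector L x z,
        (∀ p φ, gaugeX L p (W φ : CodeSpace L) = W (pauliX (Sum.inl p) φ)) ∧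
        (∀ p φ, gaugeZ L p (W φ : CodeSpace L) = W (pauliZ (Sum.inl p) φ)) ∧
        (∀ φ, hamiltonian L (W φ : CodeSpace L) =
          W (-∑ p : Site L, ((1 + ((x p : ℤ) : ℂ)) • pauliX (Sum.inl p) φ +
            (1 + ((z p : ℤ) : ℂ)) • pauliZ (Sum.inl p) φ)))) ∧
    -- the smallest and the largest eigenvalue of one gauge qubit
    (∀ x z : ℤˣ, IsLeast (gaugeQubitLevels x z) (eps0 x z) ∧
      IsGreatest (gaugeQubitLevels x z) (eps1 x z)) ∧
    (eps0 1 1 = -2 * Real.sqrt 2 ∧ eps1 1 1 = 2 * Real.sqrt 2) ∧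
    (eps0 1 (-1) = -2 ∧ eps1 1 (-1) = 2) ∧
    (eps0 (-1) 1 = -2 ∧ eps1 (-1) 1 = 2) ∧
    (eps0 (-1) (-1) = 0 ∧ eps1 (-1) (-1) = 0) ∧
    -- the entire spectrum with multiplicities, sector by sector
    (∀ x z : Site L → ℤˣ, sector L x z ≠ ⊥ → ∀ μ : ℂ,
      Module.finrank ℂ ↥(sector L x z ⊓ Module.End.eigenspace (hamiltonian L) μ) =
        4 * Nat.card {e : Site L → Bool // (configEnergy L x z e : ℂ) = μ}) ∧
    -- ground states
    IsLeast (energyLevels L) (groundEnergy L) ∧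
    Module.End.eigenspace (hamiltonian L) (groundEnergy L : ℂ) ≤ sector L 1 1 ∧
    Module.finrank ℂ (Module.End.eigenspace (hamiltonian L) (groundEnergy L : ℂ)) = 4 ∧
    -- gauge excitations: energy cost, local creation, and levels of the trivial sector
    eps1 1 1 - eps0 1 1 = 4 * Real.sqrt 2 ∧
    (∃ a b : ℂ, ∀ p : Site L,
      ∀ ψ ∈ Module.End.eigenspace (hamiltonian L) (groundEnergy L : ℂ),
        ‖(a • gaugeX L p + b • gaugeZ L p) ψ‖ = ‖ψ‖ ∧
        (a • gaugeX L p + b • gaugeZ L p) ψ ∈ sector L 1 1 ⊓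
          Module.End.eigenspace (hamiltonian L)
            ((groundEnergy L + 4 * Real.sqrt 2 : ℝ) : ℂ)) ∧
    (∀ k : ℕ, Module.finrank ℂ ↥(sector L 1 1 ⊓ Module.End.eigenspace (hamiltonian L)
        ((groundEnergy L + 4 * Real.sqrt 2 * k : ℝ) : ℂ)) = 4 * (L ^ 2).choose k) ∧
    -- syndrome excitations: energy cost of a single flip, of a pair, and of a general syndrome
    eps0 1 (-1) - eps0 1 1 = 2 * (Real.sqrt 2 - 1) ∧
    eps0 (-1) 1 - eps0 1 1 = 2 * (Real.sqrt 2 - 1) ∧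
    (∀ p q : Site L, p ≠ q →
      IsLeast (sectorLevels L (pairFlip p q) 1)
        (groundEnergy L + 2 * (2 * (Real.sqrt 2 - 1))) ∧
      IsLeast (sectorLevels L 1 (pairFlip p q))
        (groundEnergy L + 2 * (2 * (Real.sqrt 2 - 1)))) ∧
    (∀ x z : Site L → ℤˣ, sector L x z ≠ ⊥ →
      IsLeast (sectorLevels L x z)
        (groundEnergy L +
          2 * (Real.sqrt 2 - 1) * (Finset.univ.filter (fun p => x p ≠ z p)).card +
          2 * Real.sqrt 2 * (Finset.univ.filter (fun p => x p = -1 ∧ z p = -1)).card)) ∧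
    -- the gap
    (∀ μ ∈ energyLevels L, μ ≠ groundEnergy L →
      groundEnergy L + 4 * (Real.sqrt 2 - 1) ≤ μ) ∧
    (2 ≤ L → IsLeast {μ ∈ energyLevels L | groundEnergy L < μ}
      (groundEnergy L + 4 * (Real.sqrt 2 - 1))) := by
  have hground := isLeast_energyLevels (L := L)
  refine ⟨hamiltonian_isSymmetric, orthogonalFamily_sector, iSup_sector, sector_ne_bot_iff,
    fun x z h => ?_, fun x z ψ hψ => hamiltonian_apply_of_mem_sector hψ, fun x z h => ?_,
    fun x z => ?_, ?_, ?_, ?_, ?_, fun x z h μ => finrank_sector_inf_eigenspace h μ, hground,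
    ground_eigenspace_le, finrank_ground_eigenspace, ?_,
    -- The coefficients are read off from `gauge_excitation`: `√2/2` and `-√2/2`, perpendicular to
    -- the field of the trivial sector.
    ⟨_, _, fun p ψ hψ => gauge_excitation p hψ⟩, finrank_trivial_sector_level, ?_, ?_,
    fun p q hpq => isLeast_sectorLevels_pairFlip hpq, fun x z h => isLeast_sectorLevels h,
    fun μ hμ hne => energyLevels_gap hμ hne, isLeast_energyLevels_above_ground⟩
  · obtain ⟨hx, hz⟩ := (sector_ne_bot_iff x z).1 h
    exact ⟨even_card_neg_one hx, even_card_neg_one hz⟩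
  · obtain ⟨W, hX, hZ⟩ := exists_gauge_qubits h
    refine ⟨W, hX, hZ, fun φ => ?_⟩
    rw [hamiltonian_apply_of_mem_sector (W φ).2]
    simp only [hX, hZ, map_neg, map_sum, map_add, map_smul, Submodule.coe_neg, Submodule.coe_sum,
      Submodule.coe_add, Submodule.coe_smul]
  · rw [eps0_eq, eps1_eq]
    exact ⟨isLeast_gaugeQubitLevels x z, isGreatest_gaugeQubitLevels x z⟩
  all_goals
    simp only [eps0_eq, eps1_eq, gaugeEnergy_one_one, gaugeEnergy_one_neg, gaugeEnergy_neg_one,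
      gaugeEnergy_neg_neg]
  · exact ⟨by ring, trivial⟩
  · norm_num
  · norm_num
  · norm_num
  all_goals ring
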